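/- **Hollywood process.** Let $0<\alpha<1$, $\theta>-\alpha$, and let $\nu=(\nu_k)_{k\ge1}$ be a probability distribution on the positive integers. Random finite sequences $X_n=(X_{n,1},\dots,X_{n,K_n})$ of positive integers (interactions), $n\ge1$, are generated as follows. Given $X_1,\dots,X_{n-1}$, draw the arity $K_n\sim\nu$ independently of the past. Given $K_n=k$, draw $X_{n,1},\dots,X_{n,k}$ one after the other: if $V$ is the number of distinct labels that have occurred so far (in $X_1,\dots,X_{n-1}$ and $X_{n,1},\dots,X_{n,j-1}$), these labels are $1,\dots,V$, and $D(i)$ is the number of occurrences of label $i$ so far, then $X_{n,j}=i$ with conditional probability proportional to $D(i)-\alpha$ for $i=1,\dots,V$, and to $\theta+\alpha V$ for $i=V+1$; in particular $X_{1,1}=1$. Let $\mathcal Y_n$ be the edge-labeled network induced by $X_1,\dots,X_n$, i.e. the map $i\mapsto X_i$, $1\le i\le n$, modulo bijective relabelings of the vertices. For an edge-labeled network $\mathcal E$ let $e(\mathcal E)$ be the number of edges, $v(\mathcal E)$ the number of vertices that occur in at least one edge, $M_k(\mathcal E)$ the number of edges of arity $k$ (counted with repetition of vertices), and $m_\bullet(\mathcal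 E)=e(\mathcal E)^{-1}\sum_{k\ge1}kM_k(\mathcal E)$ the average arity. A sequence $(\mathcal E_n)_{n\ge1}$ with $e(\mathcal E_n)\to\infty$ is *sparse* if $$\limsup_{n\to\infty}\frac{e(\mathcal E_n)}{v(\mathcal E_n)^{m_\bullet(\mathcal E_n)}}=0 .$$ **Theorem 5.3.** Let $(\mathcal Y_n)_{n\ge1}$ obey the Hollywood process with parameter $(\alpha,\theta,\nu)$, where $0<\alpha<1$ and $\theta>-\alpha$, and let $\mu=\sum_{k\ge1}k\nu_k\in[1,\infty]$ be the mean edge arity. 1. If $\mu<\infty$, then $v(\mathcal Y_n)$ is integrable for every $n$, and $$E\big(v(\mathcal Y_n)\big)\sim\frac{\Gamma(\theta+1)}{\alpha\,\Gamma(\theta+\alpha)}\,(\mu n)^\alpha\qquad\text{as } n\to\infty,$$ where $a_n\sim b_n$ means $a_n/b_n\to1$. 2. If $1/\mu<\alpha<1$ (with $1/\infty=0$), then $(\mathcal Y_n)_{n\ge1}$ is almost surely sparse. -/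

import Mathlib

open Filter MeasureTheory
open scoped ENNReal

namespace Hollywood

/-! ### Edge-labeled networks -/

/-- An interaction process with index set `S` and population `ℕ`: every index is sent to a finite
ordered multiset of individuals, i.e. a finite sequence in which repetitions are allowed. -/
abbrev InteractionProcess (S : Type*) := S → List ℕ

/-- Two interaction processes are identified when they differ by a relabeling of the population. -/
def relabelSetoid (S : Type*) : Setoid (InteractionProcess S) where
  r I J := ∃ ρ : Equiv.Perm ℕ, ∀ i, J i = (I i).map ρ
  iseqv :=
    { refl := fun I => ⟨Equiv.refl ℕ, fun i => by simp⟩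
      symm := by
        rintro I J ⟨ρ, h⟩
        exact ⟨ρ.symm, fun i => by simp [h]⟩
      trans := by
        rintro I J K ⟨ρ, h⟩ ⟨τ, h'⟩
        exact ⟨ρ.trans τ, fun i => by simp [h, h']⟩ }

/-- Networks with edges labeled by `S` (and unlabeled vertices): interaction processes modulo
bijective relabelings of the population. -/
def EdgeLabeledNetwork (S : Type*) := Quotient (relabelSetoid S)

/-- The edge-labeled network induced by an interaction process. -/
def inducedNetwork {S : Type*} (I : InteractionProcess S) : EdgeLabeledNetwork S :=
  Quotient.mk (relabelSetoid S) I

namespace EdgeLabeledNetwork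

variable {S : Type*}

/-- `v(E)`: the number of non-isolated vertices, that is, of vertices which are involved in at
least one edge. -/
noncomputable def v (E : EdgeLabeledNetwork S) : ℕ :=
  Quotient.lift (s := relabelSetoid S)
    (fun I : InteractionProcess S => Set.ncard {a : ℕ | ∃ i, a ∈ I i})
    (by
      rintro I J ⟨ρ, h⟩
      have : {a : ℕ | ∃ i, a ∈ J i} = ρ '' {a : ℕ | ∃ i, a ∈ I i} := by
        ext a
        simp only [h, List.mem_map, Set.mem_ofPred_eq, Set.mem_image]
        constructor
        · rintro ⟨i, b, hb, rfl⟩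
          exact ⟨b, ⟨i, hb⟩, rfl⟩
        · rintro ⟨b, ⟨i, hb⟩, rfl⟩
          exact ⟨i, b, hb, rfl⟩
      simp only [this, Set.ncard_image_of_injective _ ρ.injective]) E

/-- `e(E)`: the number of edges. -/
def e [Fintype S] (_E : EdgeLabeledNetwork S) : ℕ := Fintype.card S

/-- `M_k(E)`: the number of `k`-ary edges. -/
noncomputable def M (k : ℕ) (E : EdgeLabeledNetwork S) : ℕ :=
  Quotient.lift (s := relabelSetoid S)
    (fun I : InteractionProcess S => Set.ncard {i : S | (I i).length = k})
    (by
      rintro I J ⟨ρ, h⟩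
      simp only [h, List.length_map]) E

/-- The average arity `e(E)⁻¹ ∑_{k ≥ 1} k M_k(E)` of the edges of `E` (only finitely many terms of
the sum are nonzero; the term for `k = 0` vanishes). -/
noncomputable def meanArity [Fintype S] (E : EdgeLabeledNetwork S) : ℝ :=
  (E.e : ℝ)⁻¹ * ∑ᶠ k : ℕ, (k : ℝ) * (E.M k : ℝ)

/-- Sparsity of a sequence of finite edge-labeled networks whose number of edges tends to
infinity: `limsup e(E_n) / v(E_n) ^ m(E_n) = 0`, where `m` is the average arity.  The limit superior
is taken in the extended reals. -/
def IsSparse {S : ℕ → Type*} [∀ n, Fintype (S n)] (E : ∀ n, EdgeLabeledNetwork (S n)) : Prop :=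
  Tendsto (fun n => (E n).e) atTop atTop ∧
    limsup (fun n => ((((E n).e : ℝ) / ((E n).v : ℝ) ^ (E n).meanArity : ℝ) : EReal)) atTop = 0

end EdgeLabeledNetwork

/-! ### The Hollywood process -/

/-- The unnormalized weight with which the next role is given to the actor labeled `i`, when `h` is
the list of the actors in all roles cast so far.  With `V = h.toFinset.card` the number of distinct
actors seen so far and `h.count i` the number of roles played by `i`, it is `h.count i - α` for the
seen actors `i = 1, …, V`, and `θ + α V` for the new actor `i = V + 1`. -/
noncomputable def roleWeight (α θ : ℝ) (h : List ℕ) (i : ℕ) : ℝ :=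
  if 1 ≤ i ∧ i ≤ h.toFinset.card then (h.count i : ℝ) - α
  else if i = h.toFinset.card + 1 then θ + α * h.toFinset.card
  else 0

/-- The probability that the next role is given to the actor labeled `i`, when `h` is the list of
the actors in all roles cast so far: proportional to `roleWeight`.  The very first role goes to
actor `1`, the only candidate (its weight `θ` may be zero or negative). -/
noncomputable def roleProb (α θ : ℝ) (h : List ℕ) (i : ℕ) : ℝ :=
  if h = [] then (if i = 1 then 1 else 0)
  else roleWeight α θ h i / ∑ l ∈ Finset.Icc 1 (h.toFinset.card + 1), roleWeight α θ h l

/-- The conditional probability that the next interaction is the finite sequence `s`, when `h` is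
the list of the actors in all roles of the previous interactions: the number of roles is drawn from
`ν`, and the roles are then filled one after the other. -/
noncomputable def interactionProb (α θ : ℝ) (ν : PMF ℕ) (h s : List ℕ) : ℝ :=
  (ν s.length).toReal * ∏ j : Fin s.length, roleProb α θ (h ++ s.take j) (s.get j)

/-- The list of the actors in all roles of the first `n` interactions `x 0, …, x (n - 1)`. -/
def history (x : ℕ → List ℕ) (n : ℕ) : List ℕ := ((List.range n).map x).flatten

/-- The random interactions `X 0, X 1, …` (indexed from `0`) are generated by the Hollywood
mechanism with parameter `(α, θ, ν)`: given that the first `n` interactions are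
`x 0, …, x (n - 1)`, the next one is `x n` with probability
`interactionProb α θ ν (history x n) (x n)`. -/
structure IsHollywood {Ω : Type*} [MeasurableSpace Ω] (P : Measure Ω) (α θ : ℝ) (ν : PMF ℕ)
    (X : ℕ → Ω → List ℕ) : Prop where
  measurableSet_eq : ∀ (n : ℕ) (s : List ℕ), MeasurableSet {ω | X n ω = s}
  step : ∀ (n : ℕ) (x : ℕ → List ℕ),
    P.real {ω | ∀ i < n + 1, X i ω = x i} =
      P.real {ω | ∀ i < n, X i ω = x i} * interactionProb α θ ν (history x n) (x n)

/-- The edge-labeled network `Y_n` induced by the first `n` interactions. -/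
def network {Ω : Type*} (X : ℕ → Ω → List ℕ) (n : ℕ) (ω : Ω) : EdgeLabeledNetwork (Fin n) :=
  inducedNetwork fun i : Fin n => X i ω

/-- The mean `∑_{k ≥ 1} k ν_k ∈ [0, ∞]` of the arity distribution. -/
noncomputable def arityMean (ν : PMF ℕ) : ℝ≥0∞ := ∑' k : ℕ, (k : ℝ≥0∞) * ν k

end Hollywood

/-! Write `m` for the number of roles cast and `V` for the number of actors. A role goes to a new
actor with probability `(θ + α V) / (m + θ)`, so if `(θ + α V) (w (V + 1) - w V) = κ w V`, then one
role multiplies the mean of `w V` by `(m + θ + κ) / (m + θ)`. Hence `w V * Γ(m + θ) / Γ(m + θ + κ)`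
is a martingale along the roles. Arities are drawn independently of the past, so it stays one along
interactions, even conditionally on the arities. Three eigenfunctions are used: `V + θ / α` with `κ
= α`, `1 / (V + θ / α - 1)` with `κ = -α`, and the indicator of `V = 1` with `κ = -(θ + α)`.

Mean: let `N` be the number of roles in the first `n` interactions. The first martingale, weighted
by a function of `N` (`lintegral_harmonic_mul`), expresses `E v + θ / α` as the constant of the
theorem times `E (Γ(N + θ + α) / Γ(N + θ))`. The ratio is asymptotic to `N ^ α`. The strong law and
Fatou's lemma bound its mean from below, concavity of `x ^ α` from above.

Sparsity: by the third martingale a second actor appears almost surely. From then on the second one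
bounds a weighted mean of `1 / (V + θ / α - 1)` by a multiple of `n ^ (-α)`. Summing over powers of
two gives `v ≥ n ^ β` eventually, for every `β < α` (`ae_eventually_rpow_le_card`). A truncated
strong law keeps the average arity above some `ρ > 1 / α`. Choosing `β` with `β ρ > 1` makes `n / v
^ ρ` tend to zero. -/

namespace Hollywood

/-! ### Histories with labels `1, …, V` -/

/-- The actors occurring in `h` are exactly `1, …, V`, where `V` is their number. -/
def Valid (h : List ℕ) : Prop := h.toFinset = Finset.Icc 1 h.toFinset.card

lemma Valid.nil : Valid [] := by simp [Valid]

lemma toFinset_append_singleton (h : List ℕ) (i : ℕ) :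
    (h ++ [i]).toFinset = insert i h.toFinset := by
  ext a; simp

lemma Valid.mem_iff {h : List ℕ} (hv : Valid h) {i : ℕ} :
    i ∈ h.toFinset ↔ 1 ≤ i ∧ i ≤ h.toFinset.card := by
  have : i ∈ h.toFinset ↔ i ∈ Finset.Icc 1 h.toFinset.card := by
    rw [← show h.toFinset = Finset.Icc 1 h.toFinset.card from hv]
  rw [this, Finset.mem_Icc]

lemma Valid.card_append_old {h : List ℕ} (hv : Valid h) {i : ℕ}
    (hi : i ∈ Finset.Icc 1 h.toFinset.card) :
    (h ++ [i]).toFinset.card = h.toFinset.card := by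
  rw [toFinset_append_singleton, Finset.insert_eq_of_mem (hv.mem_iff.2 (Finset.mem_Icc.1 hi))]

lemma Valid.card_append_new {h : List ℕ} (hv : Valid h) :
    (h ++ [h.toFinset.card + 1]).toFinset.card = h.toFinset.card + 1 := by
  rw [toFinset_append_singleton, Finset.card_insert_of_notMem]
  rw [hv.mem_iff]; omega

lemma Valid.append {h : List ℕ} (hv : Valid h) {i : ℕ}
    (hi : i ∈ Finset.Icc 1 (h.toFinset.card + 1)) : Valid (h ++ [i]) := by
  rw [Finset.mem_Icc] at hi
  by_cases h1 : i ≤ h.toFinset.card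
  · have hm : i ∈ h.toFinset := hv.mem_iff.2 ⟨hi.1, h1⟩
    unfold Valid
    rw [toFinset_append_singleton, Finset.insert_eq_of_mem hm]
    exact hv
  · obtain rfl : i = h.toFinset.card + 1 := by omega
    unfold Valid
    rw [hv.card_append_new, toFinset_append_singleton]
    ext a
    rw [Finset.mem_insert, hv.mem_iff, Finset.mem_Icc]
    omega

lemma card_pos_of_ne_nil {h : List ℕ} (hne : h ≠ []) : 1 ≤ h.toFinset.card := by
  rw [Nat.one_le_iff_ne_zero]
  simpa using hne

lemma card_le_card_append (h s : List ℕ) : h.toFinset.card ≤ (h ++ s).toFinset.card :=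
  Finset.card_le_card fun a ha => by simp at ha ⊢; exact Or.inl ha

/-! ### One-role transition law -/

section weights
variable {α θ : ℝ}

lemma roleProb_eq_zero {h : List ℕ} {i : ℕ} (hi : i ∉ Finset.Icc 1 (h.toFinset.card + 1)) :
    roleProb α θ h i = 0 := by
  rw [Finset.mem_Icc] at hi
  unfold roleProb
  split_ifs with h1 h2
  · subst h1; subst h2; simp at hi
  · rfl
  · unfold roleWeight
    rw [if_neg (by omega), if_neg (by omega), zero_div]

lemma Valid.sum_count {h : List ℕ} (hv : Valid h) :
    ∑ i ∈ Finset.Icc 1 h.toFinset.card, h.count i = h.length := by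
  rw [← show h.toFinset = Finset.Icc 1 h.toFinset.card from hv]
  exact List.sum_toFinset_count_eq_length h

lemma sum_roleWeight_old {h : List ℕ} (hv : Valid h) :
    ∑ i ∈ Finset.Icc 1 h.toFinset.card, roleWeight α θ h i
      = h.length - α * h.toFinset.card := by
  have : ∀ i ∈ Finset.Icc 1 h.toFinset.card, roleWeight α θ h i = (h.count i : ℝ) - α := by
    intro i hi
    rw [Finset.mem_Icc] at hi
    rw [roleWeight, if_pos hi]
  rw [Finset.sum_congr rfl this, Finset.sum_sub_distrib, ← Nat.cast_sum, hv.sum_count]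
  simp [mul_comm]

lemma roleWeight_new (h : List ℕ) :
    roleWeight α θ h (h.toFinset.card + 1) = θ + α * h.toFinset.card := by
  rw [roleWeight, if_neg (by omega), if_pos rfl]

lemma sum_roleWeight {h : List ℕ} (hv : Valid h) :
    ∑ i ∈ Finset.Icc 1 (h.toFinset.card + 1), roleWeight α θ h i = h.length + θ := by
  rw [Finset.sum_Icc_succ_top (by omega), sum_roleWeight_old hv, roleWeight_new]
  ring


lemma add_pos_of_ne_nil (hα1 : α < 1) (hθ : -α < θ) {h : List ℕ} (hne : h ≠ []) :
    0 < (h.length : ℝ) + θ := by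
  have : (1 : ℝ) ≤ h.length := by exact_mod_cast List.length_pos_iff.2 hne
  linarith

lemma Valid.roleWeight_nonneg (hα0 : 0 < α) (hα1 : α < 1) (hθ : -α < θ) {h : List ℕ}
    (hv : Valid h) (hne : h ≠ []) (i : ℕ) : 0 ≤ roleWeight α θ h i := by
  unfold roleWeight
  split_ifs with h1 h2
  · have : 1 ≤ h.count i := List.one_le_count_iff.2 (List.mem_toFinset.1 (hv.mem_iff.2 h1))
    have : (1 : ℝ) ≤ h.count i := by exact_mod_cast this
    linarith
  · have : (1 : ℝ) ≤ h.toFinset.card := by exact_mod_cast card_pos_of_ne_nil hne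
    nlinarith
  · exact le_rfl

lemma Valid.roleProb_nonneg (hα0 : 0 < α) (hα1 : α < 1) (hθ : -α < θ) {h : List ℕ}
    (hv : Valid h) (i : ℕ) : 0 ≤ roleProb α θ h i := by
  unfold roleProb
  split_ifs with h1 h2
  · exact zero_le_one
  · exact le_rfl
  · rw [sum_roleWeight hv]
    exact div_nonneg (hv.roleWeight_nonneg hα0 hα1 hθ h1 i) (add_pos_of_ne_nil hα1 hθ h1).le

lemma Valid.append_of_roleProb_ne_zero {h : List ℕ} (hv : Valid h) {i : ℕ}
    (hi : roleProb α θ h i ≠ 0) : Valid (h ++ [i]) :=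
  hv.append (by_contra fun hc => hi (roleProb_eq_zero hc))

/-- One step of the role process, applied to a function of the number of roles and of actors. -/
lemma Valid.tsum_roleProb (hα0 : 0 < α) (hα1 : α < 1) (hθ : -α < θ) {h : List ℕ}
    (hv : Valid h) (hne : h ≠ []) (f : ℕ → ℕ → ℝ)
    (hf : 0 ≤ f (h.length + 1) h.toFinset.card)
    (hf' : 0 ≤ f (h.length + 1) (h.toFinset.card + 1)) :
    ∑' i, ENNReal.ofReal (roleProb α θ h i) *
        ENNReal.ofReal (f (h ++ [i]).length (h ++ [i]).toFinset.card) =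
      ENNReal.ofReal (((h.length - α * h.toFinset.card) * f (h.length + 1) h.toFinset.card +
        (θ + α * h.toFinset.card) * f (h.length + 1) (h.toFinset.card + 1)) /
          (h.length + θ)) := by
  have hnn := hv.roleProb_nonneg hα0 hα1 hθ
  have hval : ∀ i ∈ Finset.Icc 1 (h.toFinset.card + 1),
      0 ≤ f (h ++ [i]).length (h ++ [i]).toFinset.card := by
    intro i hi
    rw [List.length_append, List.length_singleton]
    by_cases h1 : i ≤ h.toFinset.card
    · rwa [hv.card_append_old (Finset.mem_Icc.2 ⟨(Finset.mem_Icc.1 hi).1, h1⟩)]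
    · obtain rfl : i = h.toFinset.card + 1 := by
        rw [Finset.mem_Icc] at hi; omega
      rwa [hv.card_append_new]
  rw [tsum_eq_sum (s := Finset.Icc 1 (h.toFinset.card + 1))
    (fun i hi => by rw [roleProb_eq_zero hi]; simp)]
  have : ∀ i ∈ Finset.Icc 1 (h.toFinset.card + 1), ENNReal.ofReal (roleProb α θ h i) *
        ENNReal.ofReal (f (h ++ [i]).length (h ++ [i]).toFinset.card) =
      ENNReal.ofReal (roleWeight α θ h i * f (h ++ [i]).length (h ++ [i]).toFinset.card /
        (h.length + θ)) := by
    intro i hi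
    rw [← ENNReal.ofReal_mul (hnn i), roleProb, if_neg hne, sum_roleWeight hv]
    congr 1; ring
  rw [Finset.sum_congr rfl this, ← ENNReal.ofReal_sum_of_nonneg, ← Finset.sum_div,
    Finset.sum_Icc_succ_top (by omega), roleWeight_new, hv.card_append_new,
    ← sum_roleWeight_old (α := α) (θ := θ) hv, Finset.sum_mul]
  · congr 3
    · refine Finset.sum_congr rfl fun i hi => ?_
      rw [hv.card_append_old hi, List.length_append, List.length_singleton]
    · rw [List.length_append, List.length_singleton]
  · intro i hi
    exact div_nonneg (mul_nonneg (hv.roleWeight_nonneg hα0 hα1 hθ hne i) (hval i hi))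
      (add_pos_of_ne_nil hα1 hθ hne).le

/-- The probability that the roles following the history `h` are given to `s`. -/
noncomputable def rolesProb (α θ : ℝ) (h s : List ℕ) : ℝ :=
  ∏ j : Fin s.length, roleProb α θ (h ++ s.take j) (s.get j)

lemma rolesProb_nil (h : List ℕ) : rolesProb α θ h [] = 1 := by simp [rolesProb]

lemma rolesProb_cons (h s : List ℕ) (i : ℕ) :
    rolesProb α θ h (i :: s) = roleProb α θ h i * rolesProb α θ (h ++ [i]) s := by
  unfold rolesProb
  rw [show (∏ j : Fin (i :: s).length, roleProb α θ (h ++ (i :: s).take j) ((i :: s).get j)) =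
    ∏ j : Fin (s.length + 1), roleProb α θ (h ++ (i :: s).take j) ((i :: s).get j) from rfl,
    Fin.prod_univ_succ]
  simp

lemma Valid.append_of_rolesProb_ne_zero {h s : List ℕ} (hv : Valid h)
    (hs : rolesProb α θ h s ≠ 0) : Valid (h ++ s) := by
  induction s generalizing h with
  | nil => simpa using hv
  | cons i s ih =>
    rw [rolesProb_cons] at hs
    simpa using ih (hv.append_of_roleProb_ne_zero (left_ne_zero_of_mul hs))
      (right_ne_zero_of_mul hs)

/-! ### Harmonic functions of the history -/

/-- A function of the history which is harmonic for the role process on the set of valid histories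
with at least `V₀` actors. -/
def Harmonic (α θ : ℝ) (V₀ : ℕ) (φ : List ℕ → ℝ≥0∞) : Prop :=
  ∀ h, Valid h → V₀ ≤ h.toFinset.card →
    ∑' i, ENNReal.ofReal (roleProb α θ h i) * φ (h ++ [i]) = φ h

lemma tsum_list {f : List ℕ → ℝ≥0∞} : ∑' s, f s = f [] + ∑' (i : ℕ) (s : List ℕ), f (i :: s) := by
  let e : Unit ⊕ (ℕ × List ℕ) ≃ List ℕ :=
    { toFun := fun o => o.elim (fun _ => []) fun p => p.1 :: p.2
      invFun := fun l => match l with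
        | [] => Sum.inl ()
        | i :: s => Sum.inr (i, s)
      left_inv := by rintro (_ | ⟨i, s⟩) <;> rfl
      right_inv := by rintro (_ | ⟨i, s⟩) <;> rfl }
  rw [← e.tsum_eq f, Summable.tsum_sum ENNReal.summable ENNReal.summable, tsum_fintype,
    ENNReal.tsum_prod']
  simp [e]

/-- Harmonicity iterates because roles of positive probability preserve validity and never decrease
the number of actors, so the history stays in the domain. The answer does not depend on `k`, which
is what decouples the actors from the arities. -/
lemma Harmonic.tsum_rolesProb {V₀ : ℕ} {φ : List ℕ → ℝ≥0∞} (hφ : Harmonic α θ V₀ φ)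
    (hα0 : 0 < α) (hα1 : α < 1) (hθ : -α < θ) (k : ℕ) {h : List ℕ} (hv : Valid h)
    (hV : V₀ ≤ h.toFinset.card) :
    ∑' s : List ℕ, (if s.length = k then ENNReal.ofReal (rolesProb α θ h s) * φ (h ++ s) else 0)
      = φ h := by
  induction k generalizing h with
  | zero => simp [rolesProb_nil]
  | succ k ih =>
    rw [tsum_list, ← hφ h hv hV]
    simp only [List.length_nil, List.length_cons, add_left_inj, right_eq_add, Nat.add_eq_zero_iff,
      one_ne_zero, and_false, if_false, zero_add]
    refine tsum_congr fun i => ?_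
    by_cases hi : roleProb α θ h i = 0
    · simp [rolesProb_cons, hi]
    · rw [← ih (hv.append_of_roleProb_ne_zero hi) (hV.trans (card_le_card_append h [i])),
        ← ENNReal.tsum_mul_left]
      refine tsum_congr fun s => ?_
      split_ifs
      · rw [rolesProb_cons, ENNReal.ofReal_mul (hv.roleProb_nonneg hα0 hα1 hθ i), mul_assoc,
          List.append_assoc, List.singleton_append]
      · simp

lemma Harmonic.tsum_interactionProb {V₀ : ℕ} {φ : List ℕ → ℝ≥0∞} (hφ : Harmonic α θ V₀ φ)
    (hα0 : 0 < α) (hα1 : α < 1) (hθ : -α < θ) (ν : PMF ℕ) (ψ : ℕ → ℝ≥0∞) {h : List ℕ}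
    (hv : Valid h) (hV : V₀ ≤ h.toFinset.card) :
    ∑' s : List ℕ, ENNReal.ofReal (interactionProb α θ ν h s) * (ψ s.length * φ (h ++ s))
      = (∑' k, ν k * ψ k) * φ h := by
  have : ∀ s : List ℕ,
      ENNReal.ofReal (interactionProb α θ ν h s) * (ψ s.length * φ (h ++ s)) =
      ∑' k, ν k * ψ k *
        (if s.length = k then ENNReal.ofReal (rolesProb α θ h s) * φ (h ++ s) else 0) := by
    intro s
    rw [tsum_eq_single s.length (fun k hk => by rw [if_neg hk.symm, mul_zero]), if_pos rfl]
    rw [show interactionProb α θ ν h s = (ν s.length).toReal * rolesProb α θ h s from rfl,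
      ENNReal.ofReal_mul ENNReal.toReal_nonneg, ENNReal.ofReal_toReal (ν.apply_ne_top _)]
    ring
  simp_rw [this]
  rw [ENNReal.tsum_comm, ← ENNReal.tsum_mul_right]
  refine tsum_congr fun k => ?_
  rw [ENNReal.tsum_mul_left, hφ.tsum_rolesProb hα0 hα1 hθ k hv hV]

/-- The empty history is treated apart: its only successor is `[1]`, and the weights do not apply
there since `θ` may be nonpositive. This is the role of `h0`. -/
lemma harmonic_of_recurrence (hα0 : 0 < α) (hα1 : α < 1) (hθ : -α < θ) (V₀ : ℕ)
    (f : ℕ → ℕ → ℝ) (hf : ∀ m V, V₀ ≤ V → 1 ≤ V → V ≤ m → 0 ≤ f m V)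
    (h0 : V₀ = 0 → f 0 0 = f 1 1)
    (hrec : ∀ m V : ℕ, V₀ ≤ V → 1 ≤ V → V ≤ m →
      (m - α * V) * f (m + 1) V + (θ + α * V) * f (m + 1) (V + 1) = (m + θ) * f m V) :
    Harmonic α θ V₀ fun h => ENNReal.ofReal (f h.length h.toFinset.card) := by
  intro h hv hV
  by_cases hne : h = []
  · subst hne
    rw [tsum_eq_single 1 (fun i hi => by simp [roleProb, hi])]
    have : V₀ = 0 := by simpa using hV
    simp [roleProb, h0 this]
  · have h1 := card_pos_of_ne_nil hne
    have hm : h.toFinset.card ≤ h.length := List.toFinset_card_le h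
    rw [hv.tsum_roleProb hα0 hα1 hθ hne f (hf _ _ hV h1 (by omega)) (hf _ _ (by omega)
      (by omega) (by omega)), hrec _ _ hV h1 hm, mul_div_cancel_left₀ _
      (add_pos_of_ne_nil hα1 hθ hne).ne']

lemma harmonic_one (hα0 : 0 < α) (hα1 : α < 1) (hθ : -α < θ) : Harmonic α θ 0 fun _ => 1 := by
  have := harmonic_of_recurrence hα0 hα1 hθ 0 (fun _ _ => 1) (fun _ _ _ _ _ => zero_le_one)
    (fun _ => rfl) (fun m V _ _ _ => by ring)
  simpa using this

end weights

/-! ### Random variables with countably many values -/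

section countable
variable {Ω ι : Type*} [MeasurableSpace Ω] [Countable ι] {Y : Ω → ι}

lemma measurableSet_preimage_of_fibers (hY : ∀ i, MeasurableSet {ω | Y ω = i}) (s : Set ι) :
    MeasurableSet (Y ⁻¹' s) := by
  have : Y ⁻¹' s = ⋃ i ∈ s, {ω | Y ω = i} := by ext ω; simp
  rw [this]
  exact MeasurableSet.biUnion s.to_countable fun i _ => hY i

lemma measurable_comp_of_fibers {β : Type*} [MeasurableSpace β]
    (hY : ∀ i, MeasurableSet {ω | Y ω = i}) (F : ι → β) : Measurable fun ω => F (Y ω) :=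
  fun s _ => measurableSet_preimage_of_fibers hY (F ⁻¹' s)

lemma lintegral_comp_of_fibers (P : Measure Ω) (hY : ∀ i, MeasurableSet {ω | Y ω = i})
    (F : ι → ℝ≥0∞) : ∫⁻ ω, F (Y ω) ∂P = ∑' i, F i * P {ω | Y ω = i} := by
  let _ : MeasurableSpace ι := ⊤
  have hm : Measurable Y := fun s _ => measurableSet_preimage_of_fibers hY s
  rw [← lintegral_map (μ := P) (f := F) (g := Y) measurable_from_top hm, lintegral_countable']
  refine tsum_congr fun i => ?_
  rw [Measure.map_apply hm (measurableSet_singleton i)]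
  rfl

end countable

/-! ### The past as a random list -/

/-- The list of the first `n` interactions. -/
def past {Ω : Type*} (X : ℕ → Ω → List ℕ) (n : ℕ) (ω : Ω) : List (List ℕ) :=
  (List.range n).map fun i => X i ω

section past
variable {Ω : Type*} {X : ℕ → Ω → List ℕ}

lemma past_succ (n : ℕ) (ω : Ω) : past X (n + 1) ω = past X n ω ++ [X n ω] := by
  simp [past, List.range_succ]

lemma length_past (n : ℕ) (ω : Ω) : (past X n ω).length = n := by simp [past]

lemma history_succ (x : ℕ → List ℕ) (n : ℕ) : history x (n + 1) = history x n ++ x n := by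
  simp [history, List.range_succ]

lemma flatten_past (n : ℕ) (ω : Ω) : (past X n ω).flatten = history (fun i => X i ω) n := rfl

lemma past_eq_iff {n : ℕ} {l : List (List ℕ)} (hl : l.length = n) (ω : Ω) :
    past X n ω = l ↔ ∀ i < n, X i ω = l.getD i [] := by
  subst hl
  constructor
  · intro h i hi
    rw [← h]
    simp [past, hi]
  · intro h
    refine List.ext_getElem (length_past _ _) fun i h1 h2 => ?_
    have := h i h2
    simp [past, this, h2]

lemma take_past {m n : ℕ} (hmn : m ≤ n) (ω : Ω) : (past X n ω).take m = past X m ω := by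
  simp [past, ← List.map_take, List.take_range, min_eq_left hmn]

lemma length_history_succ (x : ℕ → List ℕ) (n : ℕ) :
    (history x (n + 1)).length = (history x n).length + (x n).length := by
  simp [history_succ]

end past

/-! ### Integration against the law of the next interaction -/

namespace IsHollywood

variable {Ω : Type*} [MeasurableSpace Ω] {P : Measure Ω}
  {α θ : ℝ} {ν : PMF ℕ} {X : ℕ → Ω → List ℕ}

lemma measurableSet_past_eq (hX : IsHollywood P α θ ν X) (n : ℕ) (l : List (List ℕ)) :
    MeasurableSet {ω | past X n ω = l} := by
  by_cases hl : l.length = n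
  · simp_rw [past_eq_iff hl]
    have : {ω | ∀ i < n, X i ω = l.getD i []} =
        ⋂ i, ⋂ (_ : i < n), {ω | X i ω = l.getD i []} := by
      ext ω; simp
    rw [this]
    exact MeasurableSet.iInter fun i => MeasurableSet.iInter fun _ => hX.measurableSet_eq i _
  · have : {ω | past X n ω = l} = ∅ := by
      ext ω
      simp only [Set.mem_ofPred_eq, Set.mem_empty_iff_false, iff_false]
      rintro rfl
      exact hl (length_past n ω)
    rw [this]
    exact MeasurableSet.empty

lemma measurable_past {β : Type*} [MeasurableSpace β] (hX : IsHollywood P α θ ν X) (n : ℕ)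
    (F : List (List ℕ) → β) : Measurable fun ω => F (past X n ω) :=
  measurable_comp_of_fibers (hX.measurableSet_past_eq n) F

lemma measurable_interaction {β : Type*} [MeasurableSpace β] (hX : IsHollywood P α θ ν X) (n : ℕ)
    (F : List ℕ → β) : Measurable fun ω => F (X n ω) :=
  measurable_comp_of_fibers (hX.measurableSet_eq n) F

variable [IsProbabilityMeasure P]

lemma measure_past_inter (hX : IsHollywood P α θ ν X) (n : ℕ) (l : List (List ℕ)) (s : List ℕ) :
    P {ω | past X n ω = l ∧ X n ω = s} =
      P {ω | past X n ω = l} * ENNReal.ofReal (interactionProb α θ ν l.flatten s) := by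
  by_cases hl : l.length = n
  · have h := hX.step n fun i => (l ++ [s]).getD i []
    have e1 : {ω | ∀ i < n + 1, X i ω = (l ++ [s]).getD i []} =
        {ω | past X n ω = l ∧ X n ω = s} := by
      ext ω
      rw [Set.mem_ofPred_eq, ← past_eq_iff (by simp [hl]), past_succ, Set.mem_ofPred_eq,
        List.append_singleton_inj]
    have e2 : {ω | ∀ i < n, X i ω = (l ++ [s]).getD i []} = {ω | past X n ω = l} := by
      ext ω
      rw [Set.mem_ofPred_eq, Set.mem_ofPred_eq, past_eq_iff hl]
      refine forall₂_congr fun i hi => ?_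
      rw [List.getD_append _ _ _ _ (by omega)]
    have e3 : history (fun i => (l ++ [s]).getD i []) n = l.flatten := by
      unfold history
      congr 1
      refine List.ext_getElem (by simp [hl]) fun i h1 h2 => ?_
      simp [List.getElem?_append_left h2, h2]
    have e4 : (l ++ [s]).getD n [] = s := by
      subst hl; simp
    rw [e1, e2, e3, e4] at h
    rw [← ENNReal.ofReal_toReal (measure_ne_top P {ω | past X n ω = l ∧ X n ω = s}),
      ← ENNReal.ofReal_toReal (measure_ne_top P {ω | past X n ω = l}),
      ← ENNReal.ofReal_mul ENNReal.toReal_nonneg]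
    exact congrArg ENNReal.ofReal h
  · have : {ω | past X n ω = l} = ∅ := by
      ext ω
      simp only [Set.mem_ofPred_eq, Set.mem_empty_iff_false, iff_false]
      rintro rfl
      exact hl (length_past n ω)
    have h2 : {ω | past X n ω = l ∧ X n ω = s} ⊆ {ω | past X n ω = l} := fun ω h => h.1
    rw [this] at h2 ⊢
    rw [Set.subset_empty_iff.1 h2]
    simp

/-- The law of the next interaction given the past ones, in integrated form. -/
lemma lintegral_past_interaction (hX : IsHollywood P α θ ν X) (n : ℕ)
    (F : List (List ℕ) → List ℕ → ℝ≥0∞) :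
    ∫⁻ ω, F (past X n ω) (X n ω) ∂P =
      ∫⁻ ω, ∑' s, ENNReal.ofReal (interactionProb α θ ν (past X n ω).flatten s) *
        F (past X n ω) s ∂P := by
  have hm : ∀ p : List (List ℕ) × List ℕ, MeasurableSet {ω | (past X n ω, X n ω) = p} := by
    rintro ⟨l, s⟩
    simp only [Prod.mk.injEq]
    exact (hX.measurableSet_past_eq n l).inter (hX.measurableSet_eq n s)
  rw [lintegral_comp_of_fibers P hm (fun p => F p.1 p.2), ENNReal.tsum_prod',
    lintegral_comp_of_fibers P (hX.measurableSet_past_eq n) (fun l => ∑' s,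
      ENNReal.ofReal (interactionProb α θ ν l.flatten s) * F l s)]
  refine tsum_congr fun l => ?_
  rw [← ENNReal.tsum_mul_right]
  refine tsum_congr fun s => ?_
  simp only [Prod.mk.injEq]
  rw [hX.measure_past_inter]
  ring

lemma ae_valid (hX : IsHollywood P α θ ν X) (n : ℕ) :
    ∀ᵐ ω ∂P, Valid (history (fun i => X i ω) n) := by
  classical
  induction n with
  | zero => exact Eventually.of_forall fun ω => Valid.nil
  | succ n ih =>
    -- Integrate the indicator that the next history is invalid: from a valid past, every such
    -- continuation has probability zero.
    have h := hX.lintegral_past_interaction n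
      (fun l s => if Valid (l.flatten ++ s) then 0 else 1)
    have h0 : ∫⁻ ω, ∑' s, ENNReal.ofReal (interactionProb α θ ν (past X n ω).flatten s) *
        (if Valid ((past X n ω).flatten ++ s) then 0 else 1) ∂P = 0 := by
      rw [lintegral_eq_zero_iff (hX.measurable_past n fun l =>
        ∑' s, ENNReal.ofReal (interactionProb α θ ν l.flatten s) *
          (if Valid (l.flatten ++ s) then 0 else 1))]
      filter_upwards [ih] with ω hω
      rw [Pi.zero_apply, ENNReal.tsum_eq_zero]
      intro s
      split_ifs with hs
      · simp
      · have : rolesProb α θ (past X n ω).flatten s = 0 := by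
          by_contra hc
          exact hs (Valid.append_of_rolesProb_ne_zero hω hc)
        rw [show interactionProb α θ ν (past X n ω).flatten s =
          (ν s.length).toReal * rolesProb α θ (past X n ω).flatten s from rfl, this]
        simp
    rw [h0, lintegral_eq_zero_iff] at h
    · filter_upwards [h] with ω hω
      by_contra hc
      rw [history_succ, ← flatten_past] at hc
      simp [hc] at hω
    · have := hX.measurable_past (n + 1)
        (fun l => if Valid l.flatten then (0 : ℝ≥0∞) else 1)
      simpa [past_succ] using this

/-- Integration of a harmonic function after one more interaction, weighted by a function of the
past and of the arity of this interaction. -/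
lemma lintegral_mul_harmonic (hX : IsHollywood P α θ ν X) (hα0 : 0 < α) (hα1 : α < 1)
    (hθ : -α < θ) {V₀ : ℕ} {φ : List ℕ → ℝ≥0∞} (hφ : Harmonic α θ V₀ φ) (n : ℕ)
    (G : List (List ℕ) → ℕ → ℝ≥0∞)
    (hG : ∀ ω k, G (past X n ω) k ≠ 0 → V₀ ≤ (past X n ω).flatten.toFinset.card) :
    ∫⁻ ω, G (past X n ω) (X n ω).length * φ (history (fun i => X i ω) (n + 1)) ∂P =
      ∫⁻ ω, (∑' k, ν k * G (past X n ω) k) * φ (history (fun i => X i ω) n) ∂P := by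
  have h := hX.lintegral_past_interaction n (fun l s => G l s.length * φ (l.flatten ++ s))
  simp only [flatten_past] at h
  simp_rw [history_succ]
  rw [h]
  refine lintegral_congr_ae ?_
  filter_upwards [hX.ae_valid n] with ω hω
  by_cases hV : V₀ ≤ (past X n ω).flatten.toFinset.card
  · exact hφ.tsum_interactionProb hα0 hα1 hθ ν (G (past X n ω)) hω hV
  · have : ∀ k, G (past X n ω) k = 0 := fun k => by_contra fun hc => hV (hG ω k hc)
    simp [this]

/-- The case of the constant harmonic function: the next arity has law `ν` whatever the past. -/
lemma lintegral_arity (hX : IsHollywood P α θ ν X) (hα0 : 0 < α) (hα1 : α < 1)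
    (hθ : -α < θ) (n : ℕ) (G : List (List ℕ) → ℕ → ℝ≥0∞) :
    ∫⁻ ω, G (past X n ω) (X n ω).length ∂P = ∫⁻ ω, (∑' k, ν k * G (past X n ω) k) ∂P := by
  simpa using hX.lintegral_mul_harmonic hα0 hα1 hθ (harmonic_one hα0 hα1 hθ) n G
    (fun _ _ _ => Nat.zero_le _)

/-- Given the arities, `φ` is a martingale started at the empty history, so any function of the
number of roles factors out. -/
lemma lintegral_harmonic_mul (hX : IsHollywood P α θ ν X) (hα0 : 0 < α) (hα1 : α < 1)
    (hθ : -α < θ) {φ : List ℕ → ℝ≥0∞} (hφ : Harmonic α θ 0 φ) (n : ℕ) (ψ : ℕ → ℝ≥0∞) :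
    ∫⁻ ω, ψ (history (fun i => X i ω) n).length * φ (history (fun i => X i ω) n) ∂P =
      φ [] * ∫⁻ ω, ψ (history (fun i => X i ω) n).length ∂P := by
  induction n generalizing ψ with
  | zero => simp [history, mul_comm]
  | succ n ih =>
    have h1 := hX.lintegral_mul_harmonic hα0 hα1 hθ hφ n
      (fun l k => ψ (l.flatten.length + k)) (fun _ _ _ => Nat.zero_le _)
    have h2 := hX.lintegral_arity hα0 hα1 hθ n (fun l k => ψ (l.flatten.length + k))
    simp only [flatten_past, ← length_history_succ (fun i => X i _) n] at h1 h2
    -- Averaging over the last arity replaces `ψ` by another function of the number of roles, so the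
    -- induction must range over all `ψ`.
    rw [h1, h2, ih fun m => ∑' k, ν k * ψ (m + k)]

/-- The martingale is started at time `m` instead of `0`; the support condition on `g` confines it
to the region where `φ` is harmonic. -/
lemma lintegral_harmonic_of_le (hX : IsHollywood P α θ ν X) (hα0 : 0 < α) (hα1 : α < 1)
    (hθ : -α < θ) {V₀ : ℕ} {φ : List ℕ → ℝ≥0∞} (hφ : Harmonic α θ V₀ φ) (g : List ℕ → ℝ≥0∞)
    (hg : ∀ h, g h ≠ 0 → V₀ ≤ h.toFinset.card) {m n : ℕ} (hmn : m ≤ n) :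
    ∫⁻ ω, g (history (fun i => X i ω) m) * φ (history (fun i => X i ω) n) ∂P =
      ∫⁻ ω, g (history (fun i => X i ω) m) * φ (history (fun i => X i ω) m) ∂P := by
  induction n, hmn using Nat.le_induction with
  | base => rfl
  | succ n hmn ih =>
    rw [← ih]
    have h := hX.lintegral_mul_harmonic hα0 hα1 hθ hφ n (fun l _ => g (l.take m).flatten) ?_
    · simpa only [take_past hmn, flatten_past, ENNReal.tsum_mul_right, ν.tsum_coe, one_mul] using h
    · intro ω _ hne
      refine (hg _ hne).trans (Finset.card_le_card fun a ha => ?_)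
      simp only [List.mem_toFinset, List.mem_flatten] at ha ⊢
      obtain ⟨l, hl, hal⟩ := ha
      exact ⟨l, List.mem_of_mem_take hl, hal⟩

end IsHollywood

/-! ### Bounds for ratios of Gamma values -/

section gamma

/-- Log-convexity of `Γ` between `x` and `x + 1`. -/
lemma gamma_add_le {x s : ℝ} (hx : 0 < x) (hs0 : 0 < s) (hs1 : s < 1) :
    Real.Gamma (x + s) ≤ Real.Gamma x * x ^ s := by
  have h := Real.Gamma_mul_add_mul_le_rpow_Gamma_mul_rpow_Gamma (s := x) (t := x + 1)
    (a := 1 - s) (b := s) hx (by linarith) (by linarith) hs0 (by ring)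
  have hg := Real.Gamma_pos_of_pos hx
  rw [show (1 - s) * x + s * (x + 1) = x + s by ring, Real.Gamma_add_one hx.ne',
    Real.mul_rpow hx.le hg.le, mul_left_comm, ← Real.rpow_add hg] at h
  simpa [mul_comm] using h

lemma mul_gamma_le {x s : ℝ} (hx : 0 < x) (hs0 : 0 < s) (hs1 : s < 1) :
    x * Real.Gamma x ≤ Real.Gamma (x + s) * (x + s) ^ (1 - s) := by
  have h := gamma_add_le (x := x + s) (s := 1 - s) (by linarith) (by linarith) (by linarith)
  rwa [show x + s + (1 - s) = x + 1 by ring, Real.Gamma_add_one hx.ne'] at h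

/-- The normalization `Γ(m + θ) / Γ(m + θ + κ)` which turns an eigenfunction of the number of actors
into a harmonic function. -/
noncomputable def gammaRatio (θ κ : ℝ) (m : ℕ) : ℝ :=
  Real.Gamma (m + θ) / Real.Gamma (m + θ + κ)

lemma gammaRatio_pos {θ κ : ℝ} {m : ℕ} (h1 : 0 < m + θ) (h2 : 0 < m + θ + κ) :
    0 < gammaRatio θ κ m :=
  div_pos (Real.Gamma_pos_of_pos h1) (Real.Gamma_pos_of_pos h2)

lemma gammaRatio_succ {θ κ : ℝ} {m : ℕ} (h1 : 0 < m + θ) (h2 : 0 < m + θ + κ) :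
    gammaRatio θ κ (m + 1) * (m + θ + κ) = (m + θ) * gammaRatio θ κ m := by
  unfold gammaRatio
  have := (Real.Gamma_pos_of_pos h2).ne'
  rw [show ((m + 1 : ℕ) : ℝ) + θ = m + θ + 1 by push_cast; ring,
    show (m : ℝ) + θ + 1 + κ = m + θ + κ + 1 by ring, Real.Gamma_add_one h1.ne',
    Real.Gamma_add_one h2.ne']
  field_simp

/-- For `m ≥ 2` one has `m + θ - α ≥ (1 - α) m` and `m + θ ≤ (1 + |θ|) m`, which explains the
constant below. -/
lemma exists_le_gammaRatio_neg {α θ : ℝ} (hα0 : 0 < α) (hα1 : α < 1) (hθ : -α < θ) :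
    ∃ ε > 0, ∀ m : ℕ, 2 ≤ m → ε * (m : ℝ) ^ α ≤ gammaRatio θ (-α) m := by
  refine ⟨(1 - α) / (1 + |θ|) ^ (1 - α), by have := abs_nonneg θ; have : 0 < 1 - α := by linarith
                                            positivity, fun m hm => ?_⟩
  have hm2 : (2 : ℝ) ≤ m := by exact_mod_cast hm
  have hx : 0 < (m : ℝ) + θ + -α := by linarith
  have h := mul_gamma_le hx hα0 hα1
  rw [show (m : ℝ) + θ + -α + α = m + θ by ring] at h
  have hg := Real.Gamma_pos_of_pos hx
  have hmt : 0 < (m : ℝ) + θ := by linarith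
  have h1 : ((m : ℝ) + θ) ^ (1 - α) ≤ (m : ℝ) ^ (1 - α) * (1 + |θ|) ^ (1 - α) := by
    rw [← Real.mul_rpow (by positivity) (by positivity)]
    refine Real.rpow_le_rpow hmt.le ?_ (by linarith)
    nlinarith [abs_nonneg θ, le_abs_self θ]
  have hA : 0 < (1 + |θ|) ^ (1 - α) := by positivity
  have hB : 0 < (m : ℝ) ^ (1 - α) := by positivity
  unfold gammaRatio
  rw [le_div_iff₀ hg, div_mul_eq_mul_div, div_mul_eq_mul_div, div_le_iff₀ hA]
  have h2 : (m : ℝ) ^ α * (m : ℝ) ^ (1 - α) = m := by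
    rw [← Real.rpow_add (by linarith)]; simp
  refine le_of_mul_le_mul_right ?_ hB
  calc (1 - α) * (m : ℝ) ^ α * Real.Gamma (m + θ + -α) * (m : ℝ) ^ (1 - α)
      = ((1 - α) * ((m : ℝ) ^ α * (m : ℝ) ^ (1 - α))) * Real.Gamma (m + θ + -α) := by ring
    _ ≤ (m + θ + -α) * Real.Gamma (m + θ + -α) := by
        rw [h2]; refine mul_le_mul_of_nonneg_right ?_ hg.le; nlinarith
    _ ≤ Real.Gamma (m + θ) * (m + θ) ^ (1 - α) := h
    _ ≤ Real.Gamma (m + θ) * ((m : ℝ) ^ (1 - α) * (1 + |θ|) ^ (1 - α)) :=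
        mul_le_mul_of_nonneg_left h1 (Real.Gamma_pos_of_pos hmt).le
    _ = _ := by ring

lemma tendsto_gammaRatio_atTop {α θ : ℝ} (hα1 : α < 1) (hθ : -α < θ) :
    Tendsto (gammaRatio θ (-(θ + α))) atTop atTop := by
  -- The exponent `θ + α` may exceed `1`, where the interpolation bound fails. A smaller `s`
  -- suffices for divergence, since `Γ` is increasing on `[2, ∞)`.
  set s := min (θ + α) (1 / 2) with hs
  have hs0 : 0 < s := lt_min (by linarith) (by norm_num)
  have hs1 : s ≤ 1 / 2 := min_le_right _ _
  have hst : s ≤ θ + α := min_le_left _ _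
  have ht : Tendsto (fun m : ℕ => ((m : ℝ) - α) ^ s / 2) atTop atTop := by
    refine Tendsto.atTop_div_const (by norm_num) ((tendsto_rpow_atTop hs0).comp ?_)
    exact tendsto_atTop_add_const_right _ _ tendsto_natCast_atTop_atTop
  refine tendsto_atTop_mono' _ ?_ ht
  filter_upwards [eventually_ge_atTop 3] with m hm
  have hm3 : (3 : ℝ) ≤ m := by exact_mod_cast hm
  set x := (m : ℝ) - α with hx
  have hx2 : 2 < x := by linarith
  have hx0 : 0 < x := by linarith
  have hg := Real.Gamma_pos_of_pos hx0
  have h := mul_gamma_le hx0 hs0 (by linarith)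
  have hmono : Real.Gamma (x + s) ≤ Real.Gamma (m + θ) := by
    exact Real.Gamma_strictMonoOn_Ici.monotoneOn (Set.mem_Ici.2 (by linarith))
      (Set.mem_Ici.2 (by linarith)) (by linarith)
  have h1 : (x + s) ^ (1 - s) ≤ 2 * x ^ (1 - s) := by
    calc (x + s) ^ (1 - s) ≤ (2 * x) ^ (1 - s) :=
          Real.rpow_le_rpow (by linarith) (by linarith) (by linarith)
      _ = 2 ^ (1 - s) * x ^ (1 - s) := Real.mul_rpow (by norm_num) hx0.le
      _ ≤ 2 * x ^ (1 - s) := by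
          refine mul_le_mul_of_nonneg_right ?_ (by positivity)
          calc (2 : ℝ) ^ (1 - s) ≤ 2 ^ (1 : ℝ) :=
                Real.rpow_le_rpow_of_exponent_le (by norm_num) (by linarith)
            _ = 2 := Real.rpow_one 2
  have h2 : x ^ s * x ^ (1 - s) = x := by rw [← Real.rpow_add hx0]; simp
  unfold gammaRatio
  rw [show (m : ℝ) + θ + -(θ + α) = x by rw [hx]; ring, div_le_div_iff₀ (by norm_num) hg]
  have hB : 0 < x ^ (1 - s) := by positivity
  refine le_of_mul_le_mul_right ?_ hB
  have hgs := Real.Gamma_pos_of_pos (show 0 < x + s by linarith)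
  calc x ^ s * Real.Gamma x * x ^ (1 - s) = x * Real.Gamma x := by rw [mul_right_comm, h2]
    _ ≤ _ := h
    _ ≤ Real.Gamma (m + θ) * (2 * x ^ (1 - s)) := by
        refine mul_le_mul hmono h1 (by positivity) (hgs.le.trans hmono)
    _ = _ := by ring

end gamma

/-! ### Eigenfunctions and the three martingales -/

section harmonic
variable {α θ : ℝ}

/-- The factor `(m + θ + κ) / (m + θ)` produced by one role is cancelled by the functional equation
of `Γ`. The `max 1` gives the empty history the value of `[1]`, because the first role is
deterministic. -/
lemma harmonic_of_eigenfunction (hα0 : 0 < α) (hα1 : α < 1) (hθ : -α < θ) (V₀ : ℕ) (κ : ℝ)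
    (w : ℕ → ℝ) (hw : ∀ V, V₀ ≤ V → 1 ≤ V → 0 ≤ w V)
    (hκ : ∀ m : ℕ, V₀ ≤ m → 1 ≤ m → 0 < m + θ + κ)
    (hrec : ∀ V : ℕ, V₀ ≤ V → 1 ≤ V → (θ + α * V) * (w (V + 1) - w V) = κ * w V) :
    Harmonic α θ V₀ fun h => ENNReal.ofReal
      (w (max 1 h.toFinset.card) * gammaRatio θ κ (max 1 h.length)) := by
  have hpos : ∀ m : ℕ, 1 ≤ m → 0 < (m : ℝ) + θ := by
    intro m hm
    have : (1 : ℝ) ≤ m := by exact_mod_cast hm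
    linarith
  refine harmonic_of_recurrence hα0 hα1 hθ V₀
    (fun m V => w (max 1 V) * gammaRatio θ κ (max 1 m)) ?_ ?_ ?_
  · intro m V hV hV1 hVm
    rw [max_eq_right hV1, max_eq_right (hV1.trans hVm)]
    exact mul_nonneg (hw V hV hV1) (gammaRatio_pos (hpos m (hV1.trans hVm))
      (hκ m (hV.trans hVm) (hV1.trans hVm))).le
  · intro _; rfl
  · intro m V hV hV1 hVm
    rw [max_eq_right hV1, max_eq_right (hV1.trans hVm), max_eq_right (by omega),
      max_eq_right (by omega)]
    have h1 := gammaRatio_succ (hpos m (hV1.trans hVm))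
      (hκ m (hV.trans hVm) (hV1.trans hVm))
    linear_combination gammaRatio θ κ (m + 1) * hrec V hV hV1 + w V * h1

/-- The function of the history underlying the formula for the mean number of actors. -/
noncomputable def meanHarmonic (α θ : ℝ) (h : List ℕ) : ℝ≥0∞ :=
  ENNReal.ofReal ((((max 1 h.toFinset.card : ℕ) : ℝ) + θ / α) * gammaRatio θ α (max 1 h.length))

lemma harmonic_meanHarmonic (hα0 : 0 < α) (hα1 : α < 1) (hθ : -α < θ) :
    Harmonic α θ 0 (meanHarmonic α θ) := by
  have hθα : -1 < θ / α := by rw [lt_div_iff₀ hα0]; linarith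
  refine harmonic_of_eigenfunction hα0 hα1 hθ 0 α (fun V => (V : ℝ) + θ / α) ?_ ?_ ?_
  · intro V _ hV
    have : (1 : ℝ) ≤ V := by exact_mod_cast hV
    linarith
  · intro m _ hm
    have : (1 : ℝ) ≤ m := by exact_mod_cast hm
    linarith
  · intro V _ _
    push_cast
    field_simp
    ring

/-- The function of the history controlling inverse moments of the number of actors. -/
noncomputable def inverseHarmonic (α θ : ℝ) (h : List ℕ) : ℝ≥0∞ :=
  ENNReal.ofReal ((((max 1 h.toFinset.card : ℕ) : ℝ) + θ / α - 1)⁻¹ *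
    gammaRatio θ (-α) (max 1 h.length))

/-- The restriction to two actors is needed: for `V = 1` the denominator is `θ / α`, which need not
be positive, and neither need `m + θ - α` be for `m = 1`. -/
lemma harmonic_inverseHarmonic (hα0 : 0 < α) (hα1 : α < 1) (hθ : -α < θ) :
    Harmonic α θ 2 (inverseHarmonic α θ) := by
  have hθα : -1 < θ / α := by rw [lt_div_iff₀ hα0]; linarith
  refine harmonic_of_eigenfunction hα0 hα1 hθ 2 (-α) (fun V => ((V : ℝ) + θ / α - 1)⁻¹) ?_ ?_ ?_
  · intro V hV _
    have : (2 : ℝ) ≤ V := by exact_mod_cast hV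
    exact inv_nonneg.2 (by linarith)
  · intro m hm _
    have : (2 : ℝ) ≤ m := by exact_mod_cast hm
    linarith
  · intro V hV _
    have : (2 : ℝ) ≤ V := by exact_mod_cast hV
    have h1 : (V : ℝ) + θ / α - 1 ≠ 0 := by linarith
    have h2 : (V : ℝ) + θ / α ≠ 0 := by linarith
    push_cast
    rw [show (V : ℝ) + 1 + θ / α - 1 = V + θ / α by ring,
      show θ + α * V = α * (V + θ / α) by field_simp; ring]
    generalize θ / α = t at *
    field_simp
    ring

/-- The function of the history controlling the probability that only one actor has been cast. -/
noncomputable def singleHarmonic (α θ : ℝ) (h : List ℕ) : ℝ≥0∞ :=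
  ENNReal.ofReal ((if max 1 h.toFinset.card = 1 then 1 else 0) *
    gammaRatio θ (-(θ + α)) (max 1 h.length))

lemma harmonic_singleHarmonic (hα0 : 0 < α) (hα1 : α < 1) (hθ : -α < θ) :
    Harmonic α θ 0 (singleHarmonic α θ) := by
  refine harmonic_of_eigenfunction hα0 hα1 hθ 0 (-(θ + α)) (fun V => if V = 1 then 1 else 0)
    ?_ ?_ ?_
  · intro V _ _
    split_ifs <;> norm_num
  · intro m _ hm
    have : (1 : ℝ) ≤ m := by exact_mod_cast hm
    linarith
  · intro V _ hV
    rw [if_neg (by omega)]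
    split_ifs with h
    · subst h; push_cast; ring
    · ring

end harmonic

/-! ### Network statistics in terms of the history -/

section network
variable {Ω : Type*} {X : ℕ → Ω → List ℕ}

lemma mem_history {x : ℕ → List ℕ} {n a : ℕ} : a ∈ history x n ↔ ∃ i < n, a ∈ x i := by
  simp [history]

lemma length_history (x : ℕ → List ℕ) (n : ℕ) :
    (history x n).length = ∑ i ∈ Finset.range n, (x i).length := by
  induction n with
  | zero => simp [history]
  | succ n ih => rw [length_history_succ, ih, Finset.sum_range_succ]

lemma v_network (n : ℕ) (ω : Ω) :
    (network X n ω).v = (history (fun i => X i ω) n).toFinset.card := by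
  rw [← Set.ncard_coe_finset]
  change Set.ncard {a : ℕ | ∃ i : Fin n, a ∈ X i ω} = _
  congr 1
  ext a
  simp only [Set.mem_ofPred_eq, List.coe_toFinset, mem_history]
  exact ⟨fun ⟨i, hi⟩ => ⟨i, i.2, hi⟩, fun ⟨i, hi, ha⟩ => ⟨⟨i, hi⟩, ha⟩⟩

lemma e_network (n : ℕ) (ω : Ω) : (network X n ω).e = n := Fintype.card_fin n

lemma meanArity_network (n : ℕ) (ω : Ω) :
    (network X n ω).meanArity =
      (n : ℝ)⁻¹ * ∑ i ∈ Finset.range n, ((X i ω).length : ℝ) := by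
  unfold EdgeLabeledNetwork.meanArity
  rw [e_network]
  congr 1
  have hM : ∀ k, (network X n ω).M k =
      (Finset.univ.filter fun i : Fin n => (X i ω).length = k).card := by
    intro k
    rw [← Set.ncard_coe_finset]
    change Set.ncard {i : Fin n | (X i ω).length = k} = _
    congr 1
    ext i
    simp
  simp_rw [hM]
  rw [finsum_eq_sum_of_support_subset
    (s := Finset.univ.image fun i : Fin n => (X i ω).length), ← Fin.sum_univ_eq_sum_range
      (fun i => ((X i ω).length : ℝ)), ← Finset.sum_fiberwise_of_maps_to
      (t := Finset.univ.image fun i : Fin n => (X i ω).length)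
      (g := fun i : Fin n => (X i ω).length) (fun i _ => Finset.mem_image_of_mem _ (by simp))]
  · refine Finset.sum_congr rfl fun k _ => ?_
    rw [Finset.sum_congr rfl (g := fun _ => (k : ℝ)) (fun i hi => by
      rw [(Finset.mem_filter.1 hi).2]), Finset.sum_const, nsmul_eq_mul, mul_comm]
  · intro k hk
    have hk' := right_ne_zero_of_mul (Function.mem_support.1 hk)
    rw [Nat.cast_ne_zero, Finset.card_ne_zero] at hk'
    obtain ⟨i, hi⟩ := hk'
    simp only [Finset.coe_image, Finset.coe_univ, Set.image_univ, Set.mem_range]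
    exact ⟨i, (Finset.mem_filter.1 hi).2⟩

end network

/-! ### Independence of the arities and the strong law -/

namespace IsHollywood

variable {Ω : Type*} [MeasurableSpace Ω] {P : Measure Ω}
  {α θ : ℝ} {ν : PMF ℕ} {X : ℕ → Ω → List ℕ}

lemma measurable_arity (hX : IsHollywood P α θ ν X) (n : ℕ) :
    Measurable fun ω => (X n ω).length := hX.measurable_interaction n List.length

variable [IsProbabilityMeasure P]

lemma lintegral_comp_arity (hX : IsHollywood P α θ ν X) (hα0 : 0 < α) (hα1 : α < 1)
    (hθ : -α < θ) (n : ℕ) (g : ℕ → ℝ≥0∞) :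
    ∫⁻ ω, g (X n ω).length ∂P = ∑' k, ν k * g k := by
  simpa using hX.lintegral_arity hα0 hα1 hθ n fun _ k => g k

lemma measure_arity_mem (hX : IsHollywood P α θ ν X) (hα0 : 0 < α) (hα1 : α < 1)
    (hθ : -α < θ) (n : ℕ) (B : Set ℕ) :
    P ((fun ω => (X n ω).length) ⁻¹' B) = ∑' k, ν k * B.indicator 1 k := by
  rw [← hX.lintegral_comp_arity hα0 hα1 hθ n,
    ← lintegral_indicator_one (hX.measurable_arity n (MeasurableSet.of_discrete (s := B)))]
  rfl

lemma one_le_arity (hX : IsHollywood P α θ ν X) (hα0 : 0 < α) (hα1 : α < 1)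
    (hθ : -α < θ) (hν : ν 0 = 0) : ∀ᵐ ω ∂P, ∀ n, 1 ≤ (X n ω).length := by
  rw [ae_all_iff]
  intro n
  have h := hX.measure_arity_mem hα0 hα1 hθ n {0}
  rw [tsum_eq_single 0 (fun k hk => by simp [hk]), hν, zero_mul] at h
  filter_upwards [measure_eq_zero_iff_ae_notMem.1 h] with ω hω
  simp only [Set.mem_preimage, Set.mem_singleton_iff] at hω
  omega

/-- Arity `i` is a function of the past of interaction `j`, and arity `j` has law `ν` given that
past. Pairwise independence is all the strong law asks for. -/
lemma indepFun_arity (hX : IsHollywood P α θ ν X) (hα0 : 0 < α) (hα1 : α < 1)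
    (hθ : -α < θ) {i j : ℕ} (hij : i < j) :
    ProbabilityTheory.IndepFun (fun ω => (X i ω).length) (fun ω => (X j ω).length) P := by
  rw [ProbabilityTheory.indepFun_iff_measure_inter_preimage_eq_mul]
  intro A B hA hB
  have hm := hX.measurable_arity i hA
  rw [hX.measure_arity_mem hα0 hα1 hθ j B, ← lintegral_indicator_one hm,
    ← lintegral_indicator_one (hm.inter (hX.measurable_arity j hB))]
  have hget : ∀ ω, (past X j ω).getD i [] = X i ω := by
    intro ω; simp [past, hij]
  have h := hX.lintegral_arity hα0 hα1 hθ j fun l k =>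
    A.indicator 1 (l.getD i []).length * B.indicator 1 k
  simp only [hget] at h
  rw [← lintegral_mul_const _ (measurable_one.indicator hm)]
  refine Eq.trans ?_ (h.trans ?_) <;> refine lintegral_congr fun ω => ?_
  · classical
    simp only [Set.indicator_apply, Set.mem_inter_iff, Set.mem_preimage, Pi.one_apply]
    by_cases h1 : (X i ω).length ∈ A <;> by_cases h2 : (X j ω).length ∈ B <;> simp [h1, h2]
  · rw [← ENNReal.tsum_mul_left]
    refine tsum_congr fun k => ?_
    rw [mul_left_comm]
    rfl

lemma integrable_comp_arity (hX : IsHollywood P α θ ν X) (hα0 : 0 < α) (hα1 : α < 1)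
    (hθ : -α < θ) {g : ℕ → ℝ} (hg : ∀ k, 0 ≤ g k)
    (hfin : ∑' k, ν k * ENNReal.ofReal (g k) ≠ ∞) (n : ℕ) :
    Integrable (fun ω => g (X n ω).length) P := by
  refine ⟨(hX.measurable_interaction n fun l => g l.length).aestronglyMeasurable, ?_⟩
  rw [hasFiniteIntegral_iff_ofReal (Eventually.of_forall fun ω => hg _),
    hX.lintegral_comp_arity hα0 hα1 hθ n fun k => ENNReal.ofReal (g k)]
  exact lt_top_iff_ne_top.2 hfin

lemma integral_comp_arity (hX : IsHollywood P α θ ν X) (hα0 : 0 < α) (hα1 : α < 1)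
    (hθ : -α < θ) {g : ℕ → ℝ} (hg : ∀ k, 0 ≤ g k) (n : ℕ) :
    ∫ ω, g (X n ω).length ∂P = (∑' k, ν k * ENNReal.ofReal (g k)).toReal := by
  rw [integral_eq_lintegral_of_nonneg_ae (Eventually.of_forall fun ω => hg _)
    (hX.measurable_interaction n fun l => g l.length).aestronglyMeasurable,
    hX.lintegral_comp_arity hα0 hα1 hθ n fun k => ENNReal.ofReal (g k)]

/-- The strong law of large numbers for functions of the arities. -/
lemma tendsto_average (hX : IsHollywood P α θ ν X) (hα0 : 0 < α) (hα1 : α < 1)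
    (hθ : -α < θ) {g : ℕ → ℝ} (hg : ∀ k, 0 ≤ g k)
    (hfin : ∑' k, ν k * ENNReal.ofReal (g k) ≠ ∞) :
    ∀ᵐ ω ∂P, Tendsto (fun n : ℕ => (n : ℝ)⁻¹ * ∑ i ∈ Finset.range n, g (X i ω).length) atTop
      (nhds (∑' k, ν k * ENNReal.ofReal (g k)).toReal) := by
  have hgm : Measurable g := measurable_from_top
  have h := ProbabilityTheory.strong_law_ae (μ := P) (fun n ω => g (X n ω).length)
    (hX.integrable_comp_arity hα0 hα1 hθ hg hfin 0) ?_ ?_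
  · rwa [hX.integral_comp_arity hα0 hα1 hθ hg 0] at h
  · intro i j hij
    rcases lt_or_gt_of_ne hij with h | h
    · exact (hX.indepFun_arity hα0 hα1 hθ h).comp hgm hgm
    · exact ((hX.indepFun_arity hα0 hα1 hθ h).comp hgm hgm).symm
  · intro n
    have hid : ProbabilityTheory.IdentDistrib (fun ω => (X n ω).length) (fun ω => (X 0 ω).length)
        P P :=
      ⟨(hX.measurable_arity n).aemeasurable, (hX.measurable_arity 0).aemeasurable, by
        ext B hB
        rw [Measure.map_apply (hX.measurable_arity n) hB,
          Measure.map_apply (hX.measurable_arity 0) hB,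
          hX.measure_arity_mem hα0 hα1 hθ, hX.measure_arity_mem hα0 hα1 hθ]⟩
    exact hid.comp hgm

end IsHollywood

/-! ### Asymptotics of the Gamma ratio -/

section gamma
variable {α θ : ℝ}

lemma inv_gammaRatio_le (hα0 : 0 < α) (hα1 : α < 1) (hθ : -α < θ) {m : ℕ} (hm : 1 ≤ m) :
    (gammaRatio θ α m)⁻¹ ≤ (m + θ) ^ α := by
  have hm1 : (1 : ℝ) ≤ m := by exact_mod_cast hm
  have hx : 0 < (m : ℝ) + θ := by linarith
  unfold gammaRatio
  rw [inv_div, div_le_iff₀ (Real.Gamma_pos_of_pos hx), mul_comm]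
  exact gamma_add_le hx hα0 hα1

lemma le_inv_gammaRatio (hα0 : 0 < α) (hα1 : α < 1) (hθ : -α < θ) {m : ℕ} (hm : 1 ≤ m) :
    (m + θ) / (m + θ + α) ^ (1 - α) ≤ (gammaRatio θ α m)⁻¹ := by
  have hm1 : (1 : ℝ) ≤ m := by exact_mod_cast hm
  have hx : 0 < (m : ℝ) + θ := by linarith
  unfold gammaRatio
  rw [inv_div, div_le_div_iff₀ (by positivity) (Real.Gamma_pos_of_pos hx)]
  exact mul_gamma_le hx hα0 hα1

lemma tendsto_add_const_div (c : ℝ) :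
    Tendsto (fun m : ℕ => ((m : ℝ) + c) / m) atTop (nhds 1) := by
  have h : Tendsto (fun m : ℕ => 1 + c / (m : ℝ)) atTop (nhds (1 + 0)) :=
    tendsto_const_nhds.add (tendsto_const_nhds.div_atTop tendsto_natCast_atTop_atTop)
  rw [add_zero] at h
  refine h.congr' ?_
  filter_upwards [eventually_ge_atTop 1] with m hm
  have : (m : ℝ) ≠ 0 := by positivity
  field_simp

lemma tendsto_inv_gammaRatio_div_rpow (hα0 : 0 < α) (hα1 : α < 1) (hθ : -α < θ) :
    Tendsto (fun m : ℕ => (gammaRatio θ α m)⁻¹ / (m : ℝ) ^ α) atTop (nhds 1) := by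
  have hup : Tendsto (fun m : ℕ => (((m : ℝ) + θ) / m) ^ α) atTop (nhds 1) := by
    simpa using (tendsto_add_const_div θ).rpow_const (p := α) (Or.inl one_ne_zero)
  have hlo : Tendsto (fun m : ℕ => ((m : ℝ) + θ) / m / (((m : ℝ) + (θ + α)) / m) ^ (1 - α)) atTop
      (nhds 1) := by
    have h := (tendsto_add_const_div θ).div
      ((tendsto_add_const_div (θ + α)).rpow_const (p := 1 - α) (Or.inl one_ne_zero)) (by simp)
    simpa [Pi.div_def] using h
  refine tendsto_of_tendsto_of_tendsto_of_le_of_le' hlo hup ?_ ?_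
  · filter_upwards [eventually_ge_atTop 1] with m hm
    have hm1 : (1 : ℝ) ≤ m := by exact_mod_cast hm
    have hm0 : (0 : ℝ) < m := by linarith
    rw [Real.div_rpow (by linarith) hm0.le, ← add_assoc]
    have h := le_inv_gammaRatio hα0 hα1 hθ hm
    have h2 : (m : ℝ) ^ α * (m : ℝ) ^ (1 - α) = m := by
      rw [← Real.rpow_add hm0]; simp
    rw [le_div_iff₀ (by positivity)]
    refine le_trans (le_of_eq ?_) h
    have h3 : 0 < ((m : ℝ) + θ + α) ^ (1 - α) := Real.rpow_pos_of_pos (by linarith) _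
    have h4 : 0 < (m : ℝ) ^ (1 - α) := Real.rpow_pos_of_pos hm0 _
    field_simp
    linear_combination ((m : ℝ) + θ) * h2
  · filter_upwards [eventually_ge_atTop 1] with m hm
    have hm1 : (1 : ℝ) ≤ m := by exact_mod_cast hm
    rw [Real.div_rpow (by linarith) (by linarith)]
    exact div_le_div_of_nonneg_right (inv_gammaRatio_le hα0 hα1 hθ hm) (by positivity)

/-- Concavity: the graph lies below its tangent at `y`. Integrated with `y` equal to the mean, this
is Jensen's inequality. -/
lemma rpow_le_tangent {x y : ℝ} (hx : 0 ≤ x) (hy : 0 < y) (hα0 : 0 < α) (hα1 : α < 1) :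
    x ^ α ≤ y ^ α * (1 + α * (x / y - 1)) := by
  have h := rpow_one_add_le_one_add_mul_self (s := x / y - 1) (p := α)
    (by have := div_nonneg hx hy.le; linarith) hα0.le hα1.le
  rw [add_sub_cancel, Real.div_rpow hx hy.le, div_le_iff₀ (by positivity)] at h
  linarith

lemma meanHarmonic_nil (hα0 : 0 < α) (hθ : -α < θ) :
    meanHarmonic α θ [] =
      ENNReal.ofReal (Real.Gamma (θ + 1) / (α * Real.Gamma (θ + α))) := by
  have h1 : 0 < θ + α := by linarith
  have := (Real.Gamma_pos_of_pos h1).ne'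
  unfold meanHarmonic gammaRatio
  congr 1
  simp only [List.toFinset_nil, Finset.card_empty, List.length_nil, Nat.max_zero, Nat.cast_one]
  rw [show (1 : ℝ) + θ + α = θ + α + 1 by ring, Real.Gamma_add_one h1.ne', add_comm 1 θ]
  field_simp
  ring

end gamma

/-! ### Growth of the mean number of actors -/

namespace IsHollywood

variable {Ω : Type*} [MeasurableSpace Ω] {P : Measure Ω}
  {α θ : ℝ} {ν : PMF ℕ} {X : ℕ → Ω → List ℕ}

lemma measurable_history {β : Type*} [MeasurableSpace β] (hX : IsHollywood P α θ ν X) (n : ℕ)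
    (F : List ℕ → β) : Measurable fun ω => F (history (fun i => X i ω) n) :=
  hX.measurable_past n fun l => F l.flatten

lemma le_length_history {x : ℕ → List ℕ} (hx : ∀ n, 1 ≤ (x n).length) (n : ℕ) :
    n ≤ (history x n).length := by
  rw [length_history]
  simpa using Finset.sum_le_sum fun i (_ : i ∈ Finset.range n) => hx i

variable [IsProbabilityMeasure P]

lemma tsum_arity_eq : ∑' k, ν k * ENNReal.ofReal (k : ℝ) = arityMean ν := by
  simp [arityMean, mul_comm]

lemma integrable_length_history (hX : IsHollywood P α θ ν X) (hα0 : 0 < α) (hα1 : α < 1)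
    (hθ : -α < θ) (hμ : arityMean ν ≠ ∞) (n : ℕ) :
    Integrable (fun ω => ((history (fun i => X i ω) n).length : ℝ)) P := by
  simp only [length_history, Nat.cast_sum]
  exact integrable_finsetSum _ fun i _ => hX.integrable_comp_arity hα0 hα1 hθ
    (g := fun k => (k : ℝ)) (fun k => k.cast_nonneg) (by rwa [tsum_arity_eq]) i

lemma integral_length_history (hX : IsHollywood P α θ ν X) (hα0 : 0 < α) (hα1 : α < 1)
    (hθ : -α < θ) (hμ : arityMean ν ≠ ∞) (n : ℕ) :
    ∫ ω, ((history (fun i => X i ω) n).length : ℝ) ∂P = n * (arityMean ν).toReal := by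
  simp only [length_history, Nat.cast_sum]
  rw [integral_finsetSum _ fun i _ => hX.integrable_comp_arity hα0 hα1 hθ
    (g := fun k => (k : ℝ)) (fun k => k.cast_nonneg) (by rwa [tsum_arity_eq]) i]
  simp [hX.integral_comp_arity hα0 hα1 hθ (g := fun k => (k : ℝ)) (fun k => k.cast_nonneg),
    ← tsum_arity_eq (ν := ν)]

lemma integrable_v (hX : IsHollywood P α θ ν X) (hα0 : 0 < α) (hα1 : α < 1)
    (hθ : -α < θ) (hμ : arityMean ν ≠ ∞) (n : ℕ) :
    Integrable (fun ω => ((network X n ω).v : ℝ)) P := by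
  simp only [v_network]
  refine (hX.integrable_length_history hα0 hα1 hθ hμ n).mono'
    (hX.measurable_history n fun l => (l.toFinset.card : ℝ)).aestronglyMeasurable
    (Eventually.of_forall fun ω => ?_)
  rw [Real.norm_of_nonneg (Nat.cast_nonneg _)]
  exact_mod_cast List.toFinset_card_le _

lemma one_le_arityMean (hν : ν 0 = 0) : 1 ≤ arityMean ν := by
  rw [← ν.tsum_coe]
  refine ENNReal.tsum_le_tsum fun k => ?_
  rcases Nat.eq_zero_or_pos k with rfl | hk
  · simp [hν]
  · exact le_mul_of_one_le_left' (by exact_mod_cast hk)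

/-- The mean number of actors in terms of the law of the number of roles. -/
lemma integral_v (hX : IsHollywood P α θ ν X) (hα0 : 0 < α) (hα1 : α < 1) (hθ : -α < θ)
    (hν : ν 0 = 0) (hμ : arityMean ν ≠ ∞) {n : ℕ} (hn : 1 ≤ n) :
    ∫ ω, ((network X n ω).v : ℝ) ∂P + θ / α =
      Real.Gamma (θ + 1) / (α * Real.Gamma (θ + α)) *
        (∫⁻ ω, ENNReal.ofReal (gammaRatio θ α (history (fun i => X i ω) n).length)⁻¹
          ∂P).toReal := by
  have hθα : -1 < θ / α := by rw [lt_div_iff₀ hα0]; linarith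
  have hC : 0 ≤ Real.Gamma (θ + 1) / (α * Real.Gamma (θ + α)) :=
    div_nonneg (Real.Gamma_pos_of_pos (by linarith)).le
      (mul_nonneg hα0.le (Real.Gamma_pos_of_pos (by linarith)).le)
  -- The weight is the inverse of the normalization, so that only `v + θ / α` is left under the
  -- integral.
  have h := hX.lintegral_harmonic_mul hα0 hα1 hθ (harmonic_meanHarmonic hα0 hα1 hθ) n
    fun m => ENNReal.ofReal (gammaRatio θ α m)⁻¹
  rw [meanHarmonic_nil hα0 hθ] at h
  have hlen : ∀ᵐ ω ∂P, 1 ≤ (history (fun i => X i ω) n).length := by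
    filter_upwards [hX.one_le_arity hα0 hα1 hθ hν] with ω hω
    exact hn.trans (le_length_history hω n)
  have hv : ∀ᵐ ω ∂P, 1 ≤ (history (fun i => X i ω) n).toFinset.card := by
    filter_upwards [hlen] with ω hω
    exact card_pos_of_ne_nil (List.length_pos_iff.1 hω)
  have h2 : ∫⁻ ω, ENNReal.ofReal (gammaRatio θ α (history (fun i => X i ω) n).length)⁻¹ *
      meanHarmonic α θ (history (fun i => X i ω) n) ∂P =
      ∫⁻ ω, ENNReal.ofReal ((network X n ω).v + θ / α) ∂P := by
    refine lintegral_congr_ae ?_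
    filter_upwards [hlen, hv] with ω h1 h2
    have hm : (1 : ℝ) ≤ (history (fun i => X i ω) n).length := by exact_mod_cast h1
    have hg : 0 < gammaRatio θ α (history (fun i => X i ω) n).length :=
      gammaRatio_pos (by linarith) (by linarith)
    rw [meanHarmonic, ← ENNReal.ofReal_mul (inv_nonneg.2 hg.le), max_eq_right h1,
      max_eq_right h2, v_network]
    congr 1
    field_simp
  have hint := (hX.integrable_v hα0 hα1 hθ hμ n).add (integrable_const (μ := P) (θ / α))
  have h3 : ∫ ω, ((network X n ω).v + θ / α) ∂P =
      (∫⁻ ω, ENNReal.ofReal ((network X n ω).v + θ / α) ∂P).toReal := by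
    refine integral_eq_lintegral_of_nonneg_ae ?_ hint.aestronglyMeasurable
    filter_upwards [hv] with ω h2
    have : (1 : ℝ) ≤ (network X n ω).v := by rw [v_network]; exact_mod_cast h2
    rw [Pi.zero_apply]
    linarith
  rw [← h2, h, ENNReal.toReal_mul, ENNReal.toReal_ofReal hC,
    integral_add (hX.integrable_v hα0 hα1 hθ hμ n) (integrable_const _)] at h3
  simpa using h3

lemma lintegral_inv_gammaRatio_le (hX : IsHollywood P α θ ν X) (hα0 : 0 < α) (hα1 : α < 1)
    (hθ : -α < θ) (hν : ν 0 = 0) (hμ : arityMean ν ≠ ∞) {n : ℕ} (hn : 1 ≤ n) :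
    ∫⁻ ω, ENNReal.ofReal (gammaRatio θ α (history (fun i => X i ω) n).length)⁻¹ ∂P ≤
      ENNReal.ofReal ((n * (arityMean ν).toReal + θ) ^ α) := by
  set μ := (arityMean ν).toReal with hμdef
  have hμ1 : 1 ≤ μ := by
    have := (ENNReal.toReal_le_toReal ENNReal.one_ne_top hμ).2 (one_le_arityMean hν)
    simpa using this
  have hn1 : (1 : ℝ) ≤ n := by exact_mod_cast hn
  -- `y` is the mean of the number of roles plus `θ`; at this tangent point the linear term
  -- integrates to zero.
  set y := n * μ + θ with hy
  have hy0 : 0 < y := by nlinarith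
  have hL := hX.integrable_length_history hα0 hα1 hθ hμ n
  have haff : (fun ω => y ^ α * (1 + α * (((history (fun i => X i ω) n).length + θ) / y - 1))) =
      fun ω => y ^ α * (1 - α + α * θ / y) +
        y ^ α * α / y * ((history (fun i => X i ω) n).length : ℝ) := by
    funext ω
    field_simp
    ring
  have hint : Integrable (fun ω => y ^ α *
      (1 + α * (((history (fun i => X i ω) n).length + θ) / y - 1))) P := by
    rw [haff]
    exact (integrable_const _).add (hL.const_mul _)
  have hval : ∫ ω, y ^ α * (1 + α * (((history (fun i => X i ω) n).length + θ) / y - 1)) ∂P =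
      y ^ α := by
    rw [haff, integral_add (integrable_const _) (hL.const_mul _),
      integral_const_mul (y ^ α * α / y),
      hX.integral_length_history hα0 hα1 hθ hμ n, integral_const, probReal_univ, one_smul,
      ← hμdef, show n * μ = y - θ by rw [hy]; ring]
    field_simp
    ring
  have hbound : ∀ᵐ ω ∂P, (gammaRatio θ α (history (fun i => X i ω) n).length)⁻¹ ≤
        y ^ α * (1 + α * (((history (fun i => X i ω) n).length + θ) / y - 1)) ∧
      0 ≤ (gammaRatio θ α (history (fun i => X i ω) n).length)⁻¹ := by
    filter_upwards [hX.one_le_arity hα0 hα1 hθ hν] with ω hω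
    have h1 := hn.trans (le_length_history hω n)
    have hm : (1 : ℝ) ≤ (history (fun i => X i ω) n).length := by exact_mod_cast h1
    exact ⟨(inv_gammaRatio_le hα0 hα1 hθ h1).trans
      (rpow_le_tangent (by linarith) hy0 hα0 hα1),
      (inv_pos.2 (gammaRatio_pos (by linarith) (by linarith))).le⟩
  rw [← hval, ofReal_integral_eq_lintegral_ofReal hint
    (hbound.mono fun ω h => h.2.trans h.1)]
  exact lintegral_mono_ae (hbound.mono fun ω h => ENNReal.ofReal_le_ofReal h.1)

lemma ae_tendsto_inv_gammaRatio (hX : IsHollywood P α θ ν X) (hα0 : 0 < α) (hα1 : α < 1)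
    (hθ : -α < θ) (hν : ν 0 = 0) (hμ : arityMean ν ≠ ∞) :
    ∀ᵐ ω ∂P, Tendsto (fun n : ℕ =>
      (gammaRatio θ α (history (fun i => X i ω) n).length)⁻¹ / (n : ℝ) ^ α) atTop
      (nhds ((arityMean ν).toReal ^ α)) := by
  have hS := hX.tendsto_average hα0 hα1 hθ (g := fun k => (k : ℝ)) (fun k => k.cast_nonneg)
    (by rwa [tsum_arity_eq])
  rw [tsum_arity_eq] at hS
  filter_upwards [hS, hX.one_le_arity hα0 hα1 hθ hν] with ω h1 h2
  have hN : Tendsto (fun n => (history (fun i => X i ω) n).length) atTop atTop :=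
    tendsto_atTop_mono (le_length_history h2) tendsto_id
  have h3 := ((tendsto_inv_gammaRatio_div_rpow hα0 hα1 hθ).comp hN).mul
    (h1.rpow_const (p := α) (Or.inr hα0.le))
  rw [one_mul] at h3
  refine h3.congr' ?_
  filter_upwards [eventually_ge_atTop 1] with n hn
  have hn0 : (0 : ℝ) < n := by exact_mod_cast hn
  have hm0 : (0 : ℝ) < (history (fun i => X i ω) n).length := by
    exact_mod_cast hn.trans (le_length_history h2 n)
  have hs : ∑ i ∈ Finset.range n, ((X i ω).length : ℝ) =
      (history (fun i => X i ω) n).length := by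
    rw [length_history, Nat.cast_sum]
  simp only [Function.comp_apply]
  rw [hs, Real.mul_rpow (by positivity) hm0.le, Real.inv_rpow hn0.le]
  have := Real.rpow_pos_of_pos hm0 α
  field_simp

/-- Fatou's lemma turns the almost sure limit into a lower bound; the Jensen bound gives the
matching upper one, so no uniform integrability is required. -/
lemma tendsto_lintegral_inv_gammaRatio (hX : IsHollywood P α θ ν X) (hα0 : 0 < α) (hα1 : α < 1)
    (hθ : -α < θ) (hν : ν 0 = 0) (hμ : arityMean ν ≠ ∞) :
    Tendsto (fun n : ℕ =>
      (∫⁻ ω, ENNReal.ofReal (gammaRatio θ α (history (fun i => X i ω) n).length)⁻¹ ∂P).toReal /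
        (n : ℝ) ^ α) atTop (nhds ((arityMean ν).toReal ^ α)) := by
  set μ := (arityMean ν).toReal with hμdef
  have hμ1 : 1 ≤ μ := by
    have := (ENNReal.toReal_le_toReal ENNReal.one_ne_top hμ).2 (one_le_arityMean hν)
    simpa using this
  have hscale : ∀ n : ℕ, 1 ≤ n →
      ∫⁻ ω, ENNReal.ofReal ((gammaRatio θ α (history (fun i => X i ω) n).length)⁻¹ /
        (n : ℝ) ^ α) ∂P =
      (∫⁻ ω, ENNReal.ofReal (gammaRatio θ α (history (fun i => X i ω) n).length)⁻¹ ∂P) /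
        ENNReal.ofReal ((n : ℝ) ^ α) := by
    intro n hn
    have hn0 : (0 : ℝ) < n := by exact_mod_cast hn
    simp_rw [ENNReal.ofReal_div_of_pos (Real.rpow_pos_of_pos hn0 α), div_eq_mul_inv]
    exact lintegral_mul_const _ (hX.measurable_history n fun l =>
      ENNReal.ofReal (gammaRatio θ α l.length)⁻¹)
  have hlim : Tendsto (fun n : ℕ =>
      ∫⁻ ω, ENNReal.ofReal ((gammaRatio θ α (history (fun i => X i ω) n).length)⁻¹ /
        (n : ℝ) ^ α) ∂P) atTop (nhds (ENNReal.ofReal (μ ^ α))) := by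
    have hupper : Tendsto (fun n : ℕ => ENNReal.ofReal ((μ + θ / n) ^ α)) atTop
        (nhds (ENNReal.ofReal (μ ^ α))) := by
      have h1 : Tendsto (fun n : ℕ => μ + θ / (n : ℝ)) atTop (nhds (μ + 0)) :=
        tendsto_const_nhds.add (tendsto_const_nhds.div_atTop tendsto_natCast_atTop_atTop)
      rw [add_zero] at h1
      exact ENNReal.tendsto_ofReal (h1.rpow_const (Or.inr hα0.le))
    refine tendsto_of_le_liminf_of_limsup_le ?_ ?_
    · calc ENNReal.ofReal (μ ^ α) = ∫⁻ _, ENNReal.ofReal (μ ^ α) ∂P := by simp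
        _ = ∫⁻ ω, liminf (fun n : ℕ => ENNReal.ofReal
              ((gammaRatio θ α (history (fun i => X i ω) n).length)⁻¹ / (n : ℝ) ^ α)) atTop ∂P := by
            refine lintegral_congr_ae ?_
            filter_upwards [hX.ae_tendsto_inv_gammaRatio hα0 hα1 hθ hν hμ] with ω hω
            exact (ENNReal.tendsto_ofReal hω).liminf_eq.symm
        _ ≤ _ := lintegral_liminf_le fun n => hX.measurable_history n fun l =>
            ENNReal.ofReal ((gammaRatio θ α l.length)⁻¹ / (n : ℝ) ^ α)
    · rw [← hupper.limsup_eq]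
      refine limsup_le_limsup ?_
      filter_upwards [eventually_ge_atTop 1] with n hn
      have hn1 : (1 : ℝ) ≤ n := by exact_mod_cast hn
      have hn0 : (0 : ℝ) < n := by linarith
      rw [hscale n hn]
      have hy0 : 0 ≤ n * μ + θ := by nlinarith
      rw [show μ + θ / n = (n * μ + θ) / n by field_simp, Real.div_rpow hy0 hn0.le,
        ENNReal.ofReal_div_of_pos (Real.rpow_pos_of_pos hn0 α)]
      exact ENNReal.div_le_div_right
        (hX.lintegral_inv_gammaRatio_le hα0 hα1 hθ hν hμ hn) _
  have h := (ENNReal.tendsto_toReal ENNReal.ofReal_ne_top).comp hlim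
  rw [ENNReal.toReal_ofReal (by positivity)] at h
  refine h.congr' ?_
  filter_upwards [eventually_ge_atTop 1] with n hn
  have hn0 : (0 : ℝ) < n := by exact_mod_cast hn
  rw [Function.comp_apply, hscale n hn, ENNReal.toReal_div,
    ENNReal.toReal_ofReal (by positivity)]

/-- Growth of the mean number of actors. -/
lemma isEquivalent_integral_v (hX : IsHollywood P α θ ν X) (hα0 : 0 < α) (hα1 : α < 1)
    (hθ : -α < θ) (hν : ν 0 = 0) (hμ : arityMean ν ≠ ∞) :
    Asymptotics.IsEquivalent atTop (fun n : ℕ => ∫ ω, ((network X n ω).v : ℝ) ∂P)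
      (fun n : ℕ => Real.Gamma (θ + 1) / (α * Real.Gamma (θ + α)) *
        ((arityMean ν).toReal * (n : ℝ)) ^ α) := by
  set μ := (arityMean ν).toReal with hμdef
  have hμ1 : 1 ≤ μ := by
    have := (ENNReal.toReal_le_toReal ENNReal.one_ne_top hμ).2 (one_le_arityMean hν)
    simpa using this
  set C := Real.Gamma (θ + 1) / (α * Real.Gamma (θ + α)) with hC
  have hC0 : 0 < C := div_pos (Real.Gamma_pos_of_pos (by linarith))
    (mul_pos hα0 (Real.Gamma_pos_of_pos (by linarith)))
  have hne : ∀ᶠ n : ℕ in atTop, C * (μ * (n : ℝ)) ^ α ≠ 0 := by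
    filter_upwards [eventually_ge_atTop 1] with n hn
    have hn0 : (0 : ℝ) < n := by exact_mod_cast hn
    positivity
  rw [Asymptotics.isEquivalent_iff_tendsto_one hne]
  have hrest : Tendsto (fun n : ℕ => θ / α / (n : ℝ) ^ α) atTop (nhds 0) :=
    tendsto_const_nhds.div_atTop ((tendsto_rpow_atTop hα0).comp tendsto_natCast_atTop_atTop)
  have hμα : 0 < μ ^ α := Real.rpow_pos_of_pos (by linarith) _
  have h := (((hX.tendsto_lintegral_inv_gammaRatio hα0 hα1 hθ hν hμ).const_mul C).sub
    hrest).div_const (C * μ ^ α)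
  rw [sub_zero, div_self (by positivity)] at h
  refine h.congr' ?_
  filter_upwards [eventually_ge_atTop 1] with n hn
  have hn0 : (0 : ℝ) < n := by exact_mod_cast hn
  have hv := hX.integral_v hα0 hα1 hθ hν hμ hn
  rw [Pi.div_apply, eq_sub_of_add_eq hv, Real.mul_rpow (by linarith) hn0.le, ← hC]
  have := Real.rpow_pos_of_pos hn0 α
  field_simp

end IsHollywood

/-! ### Deterministic growth estimates -/

section growth

lemma card_history_mono (x : ℕ → List ℕ) : Monotone fun n => (history x n).toFinset.card :=
  monotone_nat_of_le_succ fun n => by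
    rw [history_succ]
    exact card_le_card_append _ _

/-- A monotone sequence which grows at least like `n ^ β` along the powers of two grows at least
like `n ^ β`. -/
lemma eventually_rpow_le_of_dyadic {V : ℕ → ℕ} (hV : Monotone V) {β t : ℝ} (hβ : 0 < β)
    (ht : -1 < t) (h2 : ∃ m, 2 ≤ V m)
    (hlim : Tendsto (fun j : ℕ => ((2 ^ j : ℕ) : ℝ) ^ β * ((V (2 ^ j) : ℝ) + t - 1)⁻¹) atTop
      (nhds 0)) :
    ∀ᶠ n : ℕ in atTop, (n : ℝ) ^ β ≤ V n := by
  obtain ⟨m, hm⟩ := h2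
  -- The factor `2 ^ β` pays for passing from `n` to the power of two below it, and `1 + |t|` for
  -- replacing `V + t - 1` by `V`.
  have hδ : (0 : ℝ) < (2 ^ β * (1 + |t|))⁻¹ := by positivity
  have hev : ∀ᶠ j : ℕ in atTop, ((2 ^ j : ℕ) : ℝ) ^ β * 2 ^ β ≤ V (2 ^ j) := by
    filter_upwards [hlim.eventually (gt_mem_nhds hδ), eventually_ge_atTop m] with j hj hjm
    have hVj : 2 ≤ V (2 ^ j) := hm.trans (hV (hjm.trans Nat.lt_two_pow_self.le))
    have hVj' : (2 : ℝ) ≤ V (2 ^ j) := by exact_mod_cast hVj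
    have hp : 0 < (V (2 ^ j) : ℝ) + t - 1 := by linarith
    rw [← div_eq_mul_inv, div_lt_iff₀ hp, inv_mul_eq_div, lt_div_iff₀ (by positivity)] at hj
    have h3 : (V (2 ^ j) : ℝ) + t - 1 ≤ V (2 ^ j) * (1 + |t|) := by
      nlinarith [abs_nonneg t, le_abs_self t]
    refine le_of_mul_le_mul_right ?_ (show 0 < 1 + |t| by positivity)
    linarith
  obtain ⟨J, hJ⟩ := eventually_atTop.1 hev
  filter_upwards [eventually_ge_atTop (2 ^ J)] with n hn
  have hn0 : n ≠ 0 := by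
    have := Nat.one_le_two_pow (n := J)
    omega
  have hlog : J ≤ Nat.log 2 n := (Nat.le_log_iff_pow_le (by norm_num) hn0).2 hn
  have h1 : 2 ^ Nat.log 2 n ≤ n := Nat.pow_log_le_self 2 hn0
  have h2 : n ≤ 2 ^ Nat.log 2 n * 2 := by
    rw [← pow_succ]
    exact (Nat.lt_pow_succ_log_self (by norm_num) n).le
  calc (n : ℝ) ^ β ≤ (((2 ^ Nat.log 2 n : ℕ) : ℝ) * 2) ^ β :=
        Real.rpow_le_rpow (by positivity) (by exact_mod_cast h2) hβ.le
    _ = ((2 ^ Nat.log 2 n : ℕ) : ℝ) ^ β * 2 ^ β := Real.mul_rpow (by positivity) (by norm_num)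
    _ ≤ V (2 ^ Nat.log 2 n) := hJ _ hlog
    _ ≤ V n := by exact_mod_cast hV h1

lemma tendsto_div_rpow_of_growth {V : ℕ → ℕ} {m : ℕ → ℝ} {β ρ : ℝ} (hβ : 0 < β) (hρ : 0 < ρ)
    (hβρ : 1 < β * ρ) (hV : ∀ᶠ n : ℕ in atTop, (n : ℝ) ^ β ≤ V n)
    (hm : ∀ᶠ n : ℕ in atTop, ρ ≤ m n) :
    Tendsto (fun n : ℕ => (n : ℝ) / (V n : ℝ) ^ m n) atTop (nhds 0) := by
  have h0 : Tendsto (fun n : ℕ => (n : ℝ) ^ (-(β * ρ - 1))) atTop (nhds 0) :=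
    (tendsto_rpow_neg_atTop (by linarith)).comp tendsto_natCast_atTop_atTop
  refine tendsto_of_tendsto_of_tendsto_of_le_of_le' tendsto_const_nhds h0
    (Eventually.of_forall fun n => by positivity) ?_
  filter_upwards [hV, hm, eventually_ge_atTop 1] with n h1 h2 hn
  have hn1 : (1 : ℝ) ≤ n := by exact_mod_cast hn
  have hn0 : (0 : ℝ) < n := by linarith
  have hV1 : (1 : ℝ) ≤ V n := (Real.one_le_rpow hn1 hβ.le).trans h1
  have h3 : (n : ℝ) ^ (β * ρ) ≤ (V n : ℝ) ^ m n :=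
    calc (n : ℝ) ^ (β * ρ) = ((n : ℝ) ^ β) ^ ρ := Real.rpow_mul hn0.le _ _
      _ ≤ (V n : ℝ) ^ ρ := Real.rpow_le_rpow (by positivity) h1 hρ.le
      _ ≤ (V n : ℝ) ^ m n := Real.rpow_le_rpow_of_exponent_le hV1 h2
  calc (n : ℝ) / (V n : ℝ) ^ m n ≤ n / (n : ℝ) ^ (β * ρ) :=
        div_le_div_of_nonneg_left hn0.le (by positivity) h3
    _ = (n : ℝ) ^ (-(β * ρ - 1)) := by
        rw [show -(β * ρ - 1) = 1 - β * ρ by ring, Real.rpow_sub hn0, Real.rpow_one]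

end growth

/-! ### Almost sure growth and sparsity -/

namespace IsHollywood

variable {Ω : Type*} [MeasurableSpace Ω] {P : Measure Ω} [IsProbabilityMeasure P]
  {α θ : ℝ} {ν : PMF ℕ} {X : ℕ → Ω → List ℕ}

/-- Almost surely a second actor is cast eventually. -/
lemma ae_exists_two_le_card (hX : IsHollywood P α θ ν X) (hα0 : 0 < α) (hα1 : α < 1)
    (hθ : -α < θ) (hν : ν 0 = 0) :
    ∀ᵐ ω ∂P, ∃ n, 2 ≤ (history (fun i => X i ω) n).toFinset.card := by
  rw [ae_iff]
  set S := {ω | ¬ ∃ n, 2 ≤ (history (fun i => X i ω) n).toFinset.card} with hS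
  by_contra hne
  -- On `S` the martingale equals its normalization, which tends to infinity and so exceeds `M`;
  -- Markov's inequality then contradicts its constant mean.
  obtain ⟨M, hM⟩ := ENNReal.exists_nat_mul_gt hne
    (show singleHarmonic α θ [] ≠ ∞ from ENNReal.ofReal_ne_top)
  obtain ⟨n, hn⟩ := eventually_atTop.1
    ((tendsto_gammaRatio_atTop hα1 hθ).eventually_ge_atTop (M : ℝ))
  refine absurd hM (not_lt.2 ?_)
  have h := hX.lintegral_harmonic_mul hα0 hα1 hθ (harmonic_singleHarmonic hα0 hα1 hθ) (n + 1)
    fun _ => 1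
  simp only [one_mul, lintegral_const, measure_univ, mul_one] at h
  rw [← h]
  refine le_trans ?_ (mul_meas_ge_le_lintegral
    (hX.measurable_history (n + 1) (singleHarmonic α θ)) (M : ℝ≥0∞))
  refine mul_le_mul_right (measure_mono_ae ?_) _
  filter_upwards [hX.one_le_arity hα0 hα1 hθ hν] with ω hω hωS
  have hωS' : ¬ 2 ≤ (history (fun i => X i ω) (n + 1)).toFinset.card := fun hc => hωS ⟨n + 1, hc⟩
  change (M : ℝ≥0∞) ≤ singleHarmonic α θ (history (fun i => X i ω) (n + 1))
  have hlen := le_length_history hω (n + 1)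
  rw [singleHarmonic, if_pos (by omega), one_mul, max_eq_right (by omega), ← ENNReal.ofReal_natCast]
  exact ENNReal.ofReal_le_ofReal (hn _ (by omega))

/-- A bound for inverse moments of the number of actors, on the event that a second actor has been
cast after `m` interactions. -/
lemma exists_lintegral_inv_card_le (hX : IsHollywood P α θ ν X) (hα0 : 0 < α) (hα1 : α < 1)
    (hθ : -α < θ) (hν : ν 0 = 0) :
    ∃ g : List ℕ → ℝ≥0∞, (∀ h, 2 ≤ h.toFinset.card → g h ≠ 0) ∧ ∃ ε : ℝ, 0 < ε ∧
      ∀ m n : ℕ, m ≤ n → 2 ≤ n → ∫⁻ ω, g (history (fun i => X i ω) m) *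
        ENNReal.ofReal (((history (fun i => X i ω) n).toFinset.card : ℝ) + θ / α - 1)⁻¹ ∂P ≤
        ENNReal.ofReal (ε * (n : ℝ) ^ α)⁻¹ := by
  classical
  have hθα : -1 < θ / α := by rw [lt_div_iff₀ hα0]; linarith
  obtain ⟨ε, hε, hg⟩ := exists_le_gammaRatio_neg hα0 hα1 hθ
  -- Dividing by the martingale's value at time `m` makes the weighted mean at most `1` without any
  -- moment assumption on the arities.
  refine ⟨fun h => if 2 ≤ h.toFinset.card then (inverseHarmonic α θ h)⁻¹ else 0, ?_, ε, hε, ?_⟩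
  · intro h hh
    simp only [if_pos hh]
    exact ENNReal.inv_ne_zero.2 ENNReal.ofReal_ne_top
  intro m n hmn hn
  set g : List ℕ → ℝ≥0∞ := fun h => if 2 ≤ h.toFinset.card then (inverseHarmonic α θ h)⁻¹ else 0
    with hgdef
  have hn0 : (0 : ℝ) < n := by exact_mod_cast (show 0 < n by omega)
  have hpos : 0 < ε * (n : ℝ) ^ α := by positivity
  have h1 : ∫⁻ ω, g (history (fun i => X i ω) m) *
      inverseHarmonic α θ (history (fun i => X i ω) n) ∂P ≤ 1 := by
    rw [hX.lintegral_harmonic_of_le hα0 hα1 hθ (harmonic_inverseHarmonic hα0 hα1 hθ) g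
      (fun h hh => by by_contra hc; exact hh (if_neg hc)) hmn]
    calc _ ≤ ∫⁻ _, 1 ∂P := by
          refine lintegral_mono fun ω => ?_
          simp only [hgdef]
          split_ifs
          · exact ENNReal.inv_mul_le_one _
          · simp
      _ = 1 := by simp
  rw [ENNReal.ofReal_inv_of_pos hpos, ← one_div, ENNReal.le_div_iff_mul_le
    (Or.inl (ENNReal.ofReal_pos.2 hpos).ne') (Or.inl ENNReal.ofReal_ne_top)]
  refine le_trans ?_ h1
  rw [← lintegral_mul_const' _ _ ENNReal.ofReal_ne_top]
  refine lintegral_mono_ae ?_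
  filter_upwards [hX.one_le_arity hα0 hα1 hθ hν] with ω hω
  by_cases h2 : 2 ≤ (history (fun i => X i ω) m).toFinset.card
  · have hV : 2 ≤ (history (fun i => X i ω) n).toFinset.card :=
      h2.trans (card_history_mono _ hmn)
    have hV' : (2 : ℝ) ≤ (history (fun i => X i ω) n).toFinset.card := by exact_mod_cast hV
    have hN := le_length_history hω n
    have hw : 0 ≤ (((history (fun i => X i ω) n).toFinset.card : ℝ) + θ / α - 1)⁻¹ :=
      inv_nonneg.2 (by linarith)
    rw [mul_assoc, ← ENNReal.ofReal_mul hw, inverseHarmonic, max_eq_right (by omega),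
      max_eq_right (by omega)]
    refine mul_le_mul_right (ENNReal.ofReal_le_ofReal (mul_le_mul_of_nonneg_left ?_ hw)) _
    refine le_trans (mul_le_mul_of_nonneg_left ?_ hε.le) (hg _ (hn.trans hN))
    exact Real.rpow_le_rpow hn0.le (by exact_mod_cast hN) hα0.le
  · simp [hgdef, h2]

lemma ae_tendsto_dyadic (hX : IsHollywood P α θ ν X) (hα0 : 0 < α) (hα1 : α < 1)
    (hθ : -α < θ) (hν : ν 0 = 0) {β : ℝ} (hβα : β < α) (m : ℕ) :
    ∀ᵐ ω ∂P, 2 ≤ (history (fun i => X i ω) m).toFinset.card →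
      Tendsto (fun j : ℕ => ((2 ^ j : ℕ) : ℝ) ^ β *
        (((history (fun i => X i ω) (2 ^ j)).toFinset.card : ℝ) + θ / α - 1)⁻¹) atTop
        (nhds 0) := by
  have hθα : -1 < θ / α := by rw [lt_div_iff₀ hα0]; linarith
  obtain ⟨g, hg, ε, hε, hbound⟩ := hX.exists_lintegral_inv_card_le hα0 hα1 hθ hν
  set a : ℕ → List ℕ → ℝ≥0∞ := fun j h =>
    ENNReal.ofReal (((2 ^ j : ℕ) : ℝ) ^ β * ((h.toFinset.card : ℝ) + θ / α - 1)⁻¹) with ha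
  have hle : ∀ j, m + 1 ≤ j → ∫⁻ ω, g (history (fun i => X i ω) m) *
      a j (history (fun i => X i ω) (2 ^ j)) ∂P ≤ ENNReal.ofReal (ε⁻¹ * (2 ^ (β - α)) ^ j) := by
    intro j hj
    have hj2 : j < 2 ^ j := Nat.lt_two_pow_self
    have hb := hbound m (2 ^ j) (by omega) (by
      calc 2 = 2 ^ 1 := rfl
        _ ≤ 2 ^ j := Nat.pow_le_pow_right (by norm_num) (by omega))
    have hp : (0 : ℝ) ≤ ((2 ^ j : ℕ) : ℝ) ^ β := by positivity
    simp only [ha, ENNReal.ofReal_mul hp]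
    simp_rw [mul_left_comm]
    rw [lintegral_const_mul' _ _ ENNReal.ofReal_ne_top]
    refine (mul_le_mul_right hb _).trans (le_of_eq ?_)
    rw [← ENNReal.ofReal_mul hp]
    congr 1
    have h2 : (0 : ℝ) < (2 ^ j : ℕ) := by positivity
    rw [mul_inv, mul_left_comm, ← div_eq_mul_inv, ← Real.rpow_sub h2, ← Real.rpow_natCast,
      ← Real.rpow_mul (by norm_num), mul_comm (β - α), Real.rpow_mul (by norm_num),
      Real.rpow_natCast]
    push_cast
    rfl
  have hr : (2 : ℝ) ^ (β - α) < 1 := Real.rpow_lt_one_of_one_lt_of_neg (by norm_num) (by linarith)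
  have hsum : ∑' j, ENNReal.ofReal (ε⁻¹ * (2 ^ (β - α)) ^ j) ≠ ∞ :=
    ((summable_geometric_of_lt_one (by positivity) hr).mul_left ε⁻¹).tsum_ofReal_ne_top
  -- The shift by `m + 1` ensures `m ≤ 2 ^ j` and `2 ≤ 2 ^ j`, as the moment bound requires.
  have hmeas : ∀ j, Measurable fun ω => g (history (fun i => X i ω) m) *
      a (j + (m + 1)) (history (fun i => X i ω) (2 ^ (j + (m + 1)))) := fun j =>
    (hX.measurable_history m g).mul (hX.measurable_history _ _)
  have hfin : ∫⁻ ω, ∑' j, g (history (fun i => X i ω) m) *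
      a (j + (m + 1)) (history (fun i => X i ω) (2 ^ (j + (m + 1)))) ∂P ≠ ∞ := by
    rw [lintegral_tsum fun j => (hmeas j).aemeasurable]
    refine ne_top_of_le_ne_top hsum ?_
    refine (ENNReal.tsum_le_tsum fun j => hle (j + (m + 1)) (by omega)).trans ?_
    exact ENNReal.tsum_comp_le_tsum_of_injective (add_left_injective (m + 1))
      fun j => ENNReal.ofReal (ε⁻¹ * (2 ^ (β - α)) ^ j)
  filter_upwards [ae_lt_top (Measurable.tsum hmeas) hfin] with ω hω h2
  rw [ENNReal.tsum_mul_left] at hω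
  -- The weighted series has finite mean, hence is almost surely finite; the weight is nonzero on
  -- the event considered, so the unweighted series is finite and its terms vanish in the limit.
  have hne : ∑' j, a (j + (m + 1)) (history (fun i => X i ω) (2 ^ (j + (m + 1)))) ≠ ∞ := by
    intro hc
    rw [hc, ENNReal.mul_top (hg _ h2)] at hω
    exact lt_irrefl _ hω
  have ht := ENNReal.tendsto_atTop_zero_of_tsum_ne_top hne
  have ht' : Tendsto (fun j => a j (history (fun i => X i ω) (2 ^ j))) atTop (nhds 0) :=
    (tendsto_add_atTop_iff_nat (f := fun j => a j (history (fun i => X i ω) (2 ^ j)))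
      (m + 1)).1 ht
  have ht2 := (ENNReal.tendsto_toReal ENNReal.zero_ne_top).comp ht'
  refine Tendsto.congr' ?_ ht2
  filter_upwards [eventually_ge_atTop m] with j hj
  have hV : 2 ≤ (history (fun i => X i ω) (2 ^ j)).toFinset.card :=
    h2.trans (card_history_mono _ (hj.trans Nat.lt_two_pow_self.le))
  have hV' : (2 : ℝ) ≤ (history (fun i => X i ω) (2 ^ j)).toFinset.card := by exact_mod_cast hV
  exact ENNReal.toReal_ofReal (mul_nonneg (by positivity) (inv_nonneg.2 (by linarith)))

/-- Almost surely the number of actors grows at least like `n ^ β`, for every `β < α`. -/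
lemma ae_eventually_rpow_le_card (hX : IsHollywood P α θ ν X) (hα0 : 0 < α) (hα1 : α < 1)
    (hθ : -α < θ) (hν : ν 0 = 0) {β : ℝ} (hβ0 : 0 < β) (hβα : β < α) :
    ∀ᵐ ω ∂P, ∀ᶠ n : ℕ in atTop,
      (n : ℝ) ^ β ≤ (history (fun i => X i ω) n).toFinset.card := by
  have hθα : -1 < θ / α := by rw [lt_div_iff₀ hα0]; linarith
  filter_upwards [hX.ae_exists_two_le_card hα0 hα1 hθ hν,
    ae_all_iff.2 fun m => hX.ae_tendsto_dyadic hα0 hα1 hθ hν hβα m] with ω h2 hlim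
  obtain ⟨m, hm⟩ := h2
  exact eventually_rpow_le_of_dyadic (card_history_mono _) hβ0 hθα ⟨m, hm⟩ (hlim m hm)

/-- Almost surely the average arity eventually exceeds `ρ > 1 / α`, if the mean arity does. -/
lemma exists_ae_eventually_le_meanArity (hX : IsHollywood P α θ ν X) (hα0 : 0 < α) (hα1 : α < 1)
    (hθ : -α < θ) (hμ : (arityMean ν)⁻¹ < ENNReal.ofReal α) :
    ∃ ρ : ℝ, α⁻¹ < ρ ∧ ∀ᵐ ω ∂P, ∀ᶠ n : ℕ in atTop, ρ ≤ (network X n ω).meanArity := by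
  classical
  have h1 : (ENNReal.ofReal α)⁻¹ < arityMean ν := ENNReal.inv_lt_iff_inv_lt.1 hμ
  rw [arityMean, ENNReal.tsum_eq_iSup_sum, lt_iSup_iff] at h1
  obtain ⟨s, hs⟩ := h1
  -- Truncating to finitely many arities keeps the mean above `1 / α` and makes it finite, so the
  -- strong law applies even when the mean arity is infinite.
  set g : ℕ → ℝ := fun k => if k ∈ s then (k : ℝ) else 0 with hg
  have hg0 : ∀ k, 0 ≤ g k := fun k => by
    simp only [hg]; split_ifs <;> positivity
  have hgle : ∀ k, g k ≤ k := fun k => by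
    simp only [hg]; split_ifs <;> simp
  have hsum : ∑' k, ν k * ENNReal.ofReal (g k) = ∑ k ∈ s, (k : ℝ≥0∞) * ν k := by
    rw [tsum_eq_sum (s := s) (fun k hk => by simp [hg, hk])]
    refine Finset.sum_congr rfl fun k hk => ?_
    simp [hg, hk, mul_comm]
  have hfin : ∑' k, ν k * ENNReal.ofReal (g k) ≠ ∞ := by
    rw [hsum]
    exact ENNReal.sum_ne_top.2 fun k _ =>
      ENNReal.mul_ne_top (ENNReal.natCast_ne_top k) (ν.apply_ne_top k)
  have hlt : α⁻¹ < (∑' k, ν k * ENNReal.ofReal (g k)).toReal := by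
    rw [← hsum, ← ENNReal.ofReal_inv_of_pos hα0] at hs
    exact (ENNReal.ofReal_lt_iff_lt_toReal (by positivity) hfin).1 hs
  obtain ⟨ρ, hρ1, hρ2⟩ := exists_between hlt
  refine ⟨ρ, hρ1, ?_⟩
  filter_upwards [hX.tendsto_average hα0 hα1 hθ hg0 hfin] with ω hω
  filter_upwards [hω.eventually (lt_mem_nhds hρ2)] with n hn
  rw [meanArity_network]
  refine hn.le.trans (mul_le_mul_of_nonneg_left ?_ (by positivity))
  exact Finset.sum_le_sum fun i _ => hgle _

lemma ae_isSparse (hX : IsHollywood P α θ ν X) (hα0 : 0 < α) (hα1 : α < 1)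
    (hθ : -α < θ) (hν : ν 0 = 0) (hμ : (arityMean ν)⁻¹ < ENNReal.ofReal α) :
    ∀ᵐ ω ∂P, EdgeLabeledNetwork.IsSparse fun n => network X n ω := by
  obtain ⟨ρ, hρ, hae⟩ := hX.exists_ae_eventually_le_meanArity hα0 hα1 hθ hμ
  have hρ0 : 0 < ρ := (inv_pos.2 hα0).trans hρ
  -- The exponent satisfies `1 / ρ < β < α`; this interval is nonempty exactly because `ρ > 1 / α`.
  obtain ⟨β, hβ1, hβ2⟩ := exists_between ((inv_lt_comm₀ hα0 hρ0).1 hρ)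
  have hβ0 : 0 < β := (inv_pos.2 hρ0).trans hβ1
  have hβρ : 1 < β * ρ := by
    rwa [inv_eq_one_div, div_lt_iff₀ hρ0] at hβ1
  filter_upwards [hae, hX.ae_eventually_rpow_le_card hα0 hα1 hθ hν hβ0 hβ2] with ω h1 h2
  refine ⟨by simp only [e_network]; exact tendsto_id, ?_⟩
  have h := tendsto_div_rpow_of_growth hβ0 hρ0 hβρ h2 h1
  have h' := (continuous_coe_real_ereal.tendsto 0).comp h
  simp only [e_network, v_network]
  exact h'.limsup_eq

end IsHollywood

end Hollywood

theorem theorem5p3 {Ω : Type*} [MeasurableSpace Ω] (P : Measure Ω) [IsProbabilityMeasure P]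
    (α θ : ℝ) (hα0 : 0 < α) (hα1 : α < 1) (hθ : -α < θ)
    (ν : PMF ℕ) (hν : ν 0 = 0)
    (X : ℕ → Ω → List ℕ) (hX : Hollywood.IsHollywood P α θ ν X) :
    (Hollywood.arityMean ν ≠ ∞ →
      (∀ n : ℕ, Integrable (fun ω => ((Hollywood.network X n ω).v : ℝ)) P) ∧
      Asymptotics.IsEquivalent atTop
        (fun n : ℕ => ∫ ω, ((Hollywood.network X n ω).v : ℝ) ∂P)
        (fun n : ℕ => Real.Gamma (θ + 1) / (α * Real.Gamma (θ + α)) *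
          ((Hollywood.arityMean ν).toReal * (n : ℝ)) ^ α)) ∧
    ((Hollywood.arityMean ν)⁻¹ < ENNReal.ofReal α →
      ∀ᵐ ω ∂P, Hollywood.EdgeLabeledNetwork.IsSparse (fun n => Hollywood.network X n ω)) :=
  ⟨fun hμ => ⟨hX.integrable_v hα0 hα1 hθ hμ, hX.isEquivalent_integral_v hα0 hα1 hθ hν hμ⟩,
    fun hμ => hX.ae_isSparse hα0 hα1 hθ hν hμ⟩
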